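/- Let $\mathrm{VAR}$ be a countably infinite set of propositional variables. An assignment is a map $t\colon \mathrm{VAR}\to\{0,1\}$ and a team is a set of assignments. A (propositional) team-based logic $\mathcal L$ is given by a set of $\mathcal L$-atoms, each written as a word over a fixed finite alphabet (distinct atoms by distinct words), together with a relation $T\models\alpha$ between teams $T$ and $\mathcal L$-atoms $\alpha$. Its formulas are $$\varphi ::= \top\mid\bot\mid x\mid\lnot x\mid\alpha\mid\varphi\land\varphi\mid\varphi\lor\varphi ,\qquad x\in\mathrm{VAR},\ \alpha \text{ an } \mathcal L\text{-atom}.$$ For a team $T$: $T\models\top$ always; $T\models\bot$ iff $T=\emptyset$; $T\models x$ (resp. $T\models\lnot x$) iff $t(x)=1$ (resp. $t(x)=0$) for all $t\in T$; $T\models\varphi\land\psi$ iff $T\models\varphi$ and $T\models\psi$; and $T\models\varphi\lor\psi$ iff there are $T_1,T_2$ with $T_1\cup T_2=T$, $T_1\models\varphi$ and $T_2\models\psi$, where under strict semantics $T_1\cap T_2=\emptyset$ is required in addition, and under lax semantics it is not. In inputs a finite team is given as a table: a list of finitely many distinct variables and a list of distinct rows of bits, one row for each assignment, variables that are not listed having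 value $0$. The model checking problem for $\mathcal L$ asks, given such a team $T$ and an $\mathcal L$-formula $\varphi$, whether $T\models\varphi$; its parameter is the team size $|T|$. The $\mathcal L$-atoms are called $\mathrm P$-checkable if there is a deterministic polynomial-time algorithm that decides, given such a team $T$ and an $\mathcal L$-atom $\alpha$, whether $T\models\alpha$. Theorem. Let $\mathcal L$ be a team-based logic whose atoms are $\mathrm P$-checkable. Then, under lax as well as under strict semantics, model checking for $\mathcal L$ parameterised by team size is fixed-parameter tractable: there are a computable function $f\colon\mathbb N\to\mathbb N$, a polynomial $p$ and a deterministic algorithm (Turing machine) that decides, for every instance $\langle T,\varphi\rangle$, whether $T\models\varphi$ within $f(|T|)\cdot p(|\langle T,\varphi\rangle|)$ steps, where $|\langle T,\varphi\rangle|$ is the length of the encoding of the instance. -/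

import Mathlib

namespace TeamSemantics

/-! ### Complexity classes, over Mathlib's (multi-stack) Turing machines `Turing.FinTM2` -/

open Classical in
/-- The decision problem `yes` on instances from `α`, encoded as words over `Γ` by `enc`,
is decidable in deterministic polynomial time. -/
def IsPTime {α Γ : Type} (enc : α → List Γ) (yes : α → Prop) : Prop :=
  Nonempty (Turing.TM2ComputableInPolyTime enc Computability.encodeBool
    (fun a => decide (yes a)))

open Classical in
/-- The decision problem `yes` on instances from `α`, encoded as words over `Γ` by `enc` and
parameterised by `κ`, is fixed-parameter tractable: there are a computable function `f`,
a polynomial `p` and one deterministic machine that, on every instance `a`, halts with the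
correct answer after at most `f (κ a) * p (|enc a|)` steps. -/
def IsFPT {α Γ : Type} (enc : α → List Γ) (κ : α → ℕ) (yes : α → Prop) : Prop :=
  ∃ (f : ℕ → ℕ) (p : Polynomial ℕ) (M : Turing.TM2ComputableAux Γ Bool),
    Computable f ∧
    ∀ a : α, Nonempty (Turing.TM2OutputsInTime M.tm
      (List.map M.inputAlphabet.invFun (enc a))
      (some (List.map M.outputAlphabet.invFun (Computability.encodeBool (decide (yes a)))))
      (f (κ a) * p.eval (enc a).length))

/-! ### Syntax and semantics of propositional team based logics -/

/-- The countably infinite set of propositional variables: every binary word is (the name of)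
a variable. -/
abbrev Var : Type := List Bool

/-- An assignment `VAR → {0, 1}`. -/
abbrev Assignment : Type := Var → Bool

/-- A team is a set of assignments. -/
abbrev Team : Type := Set Assignment

/-- A propositional team based logic is determined by its atoms: a set of atoms, a representation
of them by words over a finite alphabet, and the satisfaction relation between teams and atoms. -/
structure Logic where
  /-- the atoms of the logic (besides `⊤`, `⊥` and literals) -/
  Atom : Type
  /-- the alphabet in which atoms are written down -/
  Alphabet : Type
  [alphabetFinite : Finite Alphabet]
  /-- how atoms are written down -/
  code : Computability.Encoding Atom Alphabet
  /-- `sat T α` means `T ⊨ α` -/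
  sat : Team → Atom → Prop

/-- Formulas: propositional logic in negation normal form, extended by the atoms in `A`. -/
inductive Formula (A : Type) : Type
  | top : Formula A
  | bot : Formula A
  | pos (x : Var) : Formula A
  | neg (x : Var) : Formula A
  | atom (α : A) : Formula A
  | and (φ ψ : Formula A) : Formula A
  | or (φ ψ : Formula A) : Formula A

/-- The two semantics of the split-junction. -/
inductive Semantics : Type
  | lax
  | strict

/-- `T` may be split into `T₁` and `T₂`: lax splits are covers, strict splits are partitions
(in which a part may be empty). -/
def Semantics.IsSplit : Semantics → Team → Team → Team → Prop
  | .lax, T, T₁, T₂ => T₁ ∪ T₂ = T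
  | .strict, T, T₁, T₂ => T₁ ∪ T₂ = T ∧ Disjoint T₁ T₂

/-- `L.Sat m T φ` is `T ⊨ φ` in the logic `L` under the semantics `m`. -/
def Logic.Sat (L : Logic) (m : Semantics) : Team → Formula L.Atom → Prop
  | _, .top => True
  | T, .bot => T = ∅
  | T, .pos x => ∀ t ∈ T, t x = true
  | T, .neg x => ∀ t ∈ T, t x = false
  | T, .atom α => L.sat T α
  | T, .and φ ψ => L.Sat m T φ ∧ L.Sat m T ψ
  | T, .or φ ψ => ∃ T₁ T₂ : Team, m.IsSplit T T₁ T₂ ∧ L.Sat m T₁ φ ∧ L.Sat m T₂ ψ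

/-! ### Instances of the model checking problem and their encoding -/

/-- A finite team as given in an input: a table whose columns are labelled by finitely many
pairwise distinct variables, and whose rows are the (pairwise distinct) assignments. -/
structure TeamTable where
  /-- the column labels -/
  vars : List Var
  /-- the rows -/
  rows : List (List Bool)
  vars_nodup : vars.Nodup
  rows_nodup : rows.Nodup
  length_row : ∀ r ∈ rows, r.length = vars.length

/-- The assignment given by a row `r` under the column labels `vars`; variables without a column
get the value `0`. -/
def rowAssignment (vars : List Var) (r : List Bool) : Assignment :=
  fun x => r.getD (vars.idxOf x) false

/-- The team given by a table. -/
def TeamTable.team (T : TeamTable) : Team :=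
  {s | ∃ r ∈ T.rows, s = rowAssignment T.vars r}

/-- The size of the team, that is, its number of assignments. -/
noncomputable def TeamTable.teamSize (T : TeamTable) : ℕ :=
  T.team.ncard

/-- The alphabet in which instances are written down; `Γ` is the alphabet for atoms. -/
inductive Symbol (Γ : Type) : Type
  | bit (b : Bool)
  | chr (g : Γ)
  | endmark
  | bar
  | top
  | bot
  | pos
  | neg
  | atom
  | and
  | or

/-- A binary word, followed by an end marker. -/
def encodeWord {Γ : Type} (w : List Bool) : List (Symbol Γ) :=
  w.map Symbol.bit ++ [Symbol.endmark]

/-- A table is written as its column labels followed by its rows. -/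
def TeamTable.encode {Γ : Type} (T : TeamTable) : List (Symbol Γ) :=
  T.vars.flatMap encodeWord ++ [Symbol.bar] ++ T.rows.flatMap encodeWord ++ [Symbol.bar]

/-- Formulas are written in (parenthesis-free) reverse Polish notation. -/
def Logic.encodeFormula (L : Logic) : Formula L.Atom → List (Symbol L.Alphabet)
  | .top => [Symbol.top]
  | .bot => [Symbol.bot]
  | .pos x => Symbol.pos :: encodeWord x
  | .neg x => Symbol.neg :: encodeWord x
  | .atom α => Symbol.atom :: ((L.code.encode α).map Symbol.chr ++ [Symbol.endmark])
  | .and φ ψ => L.encodeFormula φ ++ L.encodeFormula ψ ++ [Symbol.and]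
  | .or φ ψ => L.encodeFormula φ ++ L.encodeFormula ψ ++ [Symbol.or]

/-- The word encoding an instance `⟨T, φ⟩` of the model checking problem. -/
def Logic.encodeInstance (L : Logic) (i : TeamTable × Formula L.Atom) :
    List (Symbol L.Alphabet) :=
  i.1.encode ++ L.encodeFormula i.2

/-- The atoms of `L` are polynomial-time checkable: given a finite team `T` and an atom `α`,
it can be checked in polynomial time whether `T ⊨ α`. -/
def Logic.AtomsPTimeCheckable (L : Logic) : Prop :=
  IsPTime (fun i : TeamTable × L.Atom => L.encodeInstance (i.1, Formula.atom i.2))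
    (fun i => L.sat i.1.team i.2)

/-- The model checking problem of `L` under the semantics `m`: given `⟨T, φ⟩`, does `T ⊨ φ`? -/
def Logic.ModelChecking (L : Logic) (m : Semantics) (i : TeamTable × Formula L.Atom) : Prop :=
  L.Sat m i.1.team i.2

end TeamSemantics

/-!
Model checking is decided bottom-up along the formula. A team with `k` assignments, given by a
table with `k` rows, has `2 ^ k` subteams, and these correspond to the bit masks of length `k`
(the assignments given by different rows are different, because the column labels are different).
To every subformula belongs the vector of its truth values in all subteams. The vector of a
literal is read off the table, and that of an atom is obtained by asking the polynomial-time
machine for atoms once for every mask. For `φ ∧ ψ` the two vectors are combined entry by entry.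
For `φ ∨ ψ` and a subteam `u` all pairs of masks `v`, `w` are tried: the parts of a split of `u`
are subsets of `u`, so they are subteams themselves, and whether `v` and `w` form a (lax or
strict) split of `u` is seen by comparing bits (`TeamTable.isSplit_team_sub_iff`, `sat_or_iff`).
As formulas are written in reverse Polish notation, one pass over the input with a stack of such
vectors evaluates the whole formula (`Prog.loopRuns_encodeFormula`). The answer is the entry of
the mask that selects all rows; it is the first one of the vector.

To obtain a Turing machine with a time bound, the algorithm is written in a small language `Prog`
of programs over finitely many stacks, in which every loop runs once over the present content of a
stack, and which can call a machine for the atoms. Programs are compiled into `Turing.FinTM2`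
machines; the correctness of the compiler (`code_correct`) says that a program whose weakest
precondition `Prog.wp O B` holds halts with the right result, and that if all stacks that are
looped over have at most `B` symbols, then the number of steps is at most a fixed polynomial
`Prog.cost` in `B`, which depends only on the program and the machine for the atoms. The weakest
precondition includes the bound `B`, so that correctness and running time are established
together, by `Prog.Runs.modelCheck`.

With `N` the length of the input, `B = 4 ^ (k + 1) * (N + 1)` is large enough for all stacks.
Since `W (a * b) ≤ W a * W b` for polynomials `W` with natural coefficients, the number of steps
is at most `W (4 ^ (k + 1)) * W (N + 1)`, which is a computable function of `k` times a polynomial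
in `N`.
-/

namespace TeamSemantics

open Turing Function

/-! ### A small imperative language over stacks -/

noncomputable instance {Γ : Type} [Finite Γ] : Fintype (Symbol Γ) := by
  classical
  have : Function.Surjective (fun x : (Bool ⊕ Γ) ⊕ Fin 9 => (match x with
    | .inl (.inl b) => Symbol.bit b
    | .inl (.inr g) => Symbol.chr g
    | .inr i => ![Symbol.endmark, .bar, .top, .bot, .pos, .neg, .atom, .and, .or] i :
      Symbol Γ)) := by
    intro s
    cases s with
    | bit b => exact ⟨.inl (.inl b), rfl⟩
    | chr g => exact ⟨.inl (.inr g), rfl⟩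
    | endmark => exact ⟨.inr 0, rfl⟩
    | bar => exact ⟨.inr 1, rfl⟩
    | top => exact ⟨.inr 2, rfl⟩
    | bot => exact ⟨.inr 3, rfl⟩
    | pos => exact ⟨.inr 4, rfl⟩
    | neg => exact ⟨.inr 5, rfl⟩
    | atom => exact ⟨.inr 6, rfl⟩
    | and => exact ⟨.inr 7, rfl⟩
    | or => exact ⟨.inr 8, rfl⟩
  have : Finite (Symbol Γ) := Finite.of_surjective _ this
  exact Fintype.ofFinite _

/-- A machine deciding a promise problem in polynomial time: `ans w b` says that `w` is a
legitimate input and that `b` is the answer to it. On other inputs nothing is known about the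
machine, not even that it halts. -/
structure Oracle (A : Type) where
  /-- the machine -/
  aux : TM2ComputableAux A Bool
  /-- its running time -/
  time : Polynomial ℕ
  /-- the graph of the partial function that it computes -/
  ans : List A → Bool → Prop
  correct : ∀ w b, ans w b → Nonempty (TM2OutputsInTime aux.tm
    (w.map aux.inputAlphabet.invFun)
    (some ((Computability.encodeBool b).map aux.outputAlphabet.invFun)) (time.eval w.length))

/-- Programs over stacks indexed by `V` that hold symbols from `Symbol Γ`.

`case x k` branches on the topmost symbol of `x`; `loop x k` runs `k a` for every symbol `a` that
is on `x` when the loop is entered, from the top downwards, so that its body may change `x` freely;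
`call x y` asks the oracle about the content of `x`, read from the bottom, empties `x` and pushes
the answer to `y`. -/
inductive Prog (V Γ : Type) : Type
  | skip : Prog V Γ
  | push (x : V) (a : Symbol Γ) : Prog V Γ
  | pop (x : V) : Prog V Γ
  | seq (p q : Prog V Γ) : Prog V Γ
  | case (x : V) (k : Option (Symbol Γ) → Prog V Γ) : Prog V Γ
  | loop (x : V) (k : Symbol Γ → Prog V Γ) : Prog V Γ
  | call (x y : V) : Prog V Γ

namespace Prog

variable {V Γ : Type}

/-- The contents of the stacks. -/
abbrev Store (V Γ : Type) : Type := V → List (Symbol Γ)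

/-- The weakest precondition of a loop that still has to run over `l`, where `f a` is the weakest
precondition transformer of the body for the symbol `a`. -/
def wpLoop (f : Symbol Γ → (Store V Γ → Prop) → Store V Γ → Prop) :
    List (Symbol Γ) → (Store V Γ → Prop) → Store V Γ → Prop
  | [], Q, S => Q S
  | a :: l, Q, S => f a (wpLoop f l Q) S

/-- `wp O B p Q S`: started in the store `S`, the program `p` ends in a store that satisfies `Q`;
in addition, on the way every stack that is looped over or handed to the oracle `O`
has at most `B` symbols, and `O` is asked legitimate questions only. -/
def wp [DecidableEq V] (O : Oracle (Symbol Γ)) (B : ℕ) :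
    Prog V Γ → (Store V Γ → Prop) → Store V Γ → Prop
  | skip, Q, S => Q S
  | push x a, Q, S => Q (update S x (a :: S x))
  | pop x, Q, S => Q (update S x (S x).tail)
  | seq p q, Q, S => wp O B p (wp O B q Q) S
  | case x k, Q, S => wp O B (k (S x).head?) Q S
  | loop x k, Q, S => (S x).length ≤ B ∧ wpLoop (fun a => wp O B (k a)) (S x) Q S
  | call x y, Q, S => (S x).length ≤ B ∧
      ∃ b, O.ans (S x).reverse b ∧
        Q (update (update S x []) y (Symbol.bit b :: update S x [] y))

/-- The nesting depth of loops. -/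
noncomputable def depth [Finite Γ] : Prog V Γ → ℕ
  | skip | push _ _ | pop _ | call _ _ => 0
  | seq p q => max p.depth q.depth
  | case _ k => Finset.univ.sup fun o => (k o).depth
  | loop _ k => (Finset.univ.sup fun a => (k a).depth) + 1

/-- A bound for the number of machine steps, as a polynomial in the bound `B` on the lengths of the
stacks that the program loops over or hands to the oracle. -/
noncomputable def cost [Finite Γ] (O : Oracle (Symbol Γ)) : Prog V Γ → Polynomial ℕ
  | skip | push _ _ | pop _ => 1
  | seq p q => p.cost O + q.cost O
  | case _ k => 1 + ∑ o, (k o).cost O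
  | loop _ k => 2 * (Polynomial.X + 1) + (Polynomial.X * (1 + ∑ a, (k a).cost O) + 1)
  | call _ _ => (Polynomial.X + 1) + O.time + 1

/-- The labels of the compiled program. -/
def Lab (O : Oracle (Symbol Γ)) : Prog V Γ → Type
  | skip | push _ _ | pop _ => Unit
  | seq p q => p.Lab O ⊕ q.Lab O
  | case _ k => Unit ⊕ Σ o, (k o).Lab O
  | loop _ k => Fin 3 ⊕ Σ a, (k a).Lab O
  | call _ _ => Bool ⊕ O.aux.tm.Λ

/-- The labels are finite, as the alphabet of the program and the oracle are. -/
theorem finite_lab [Finite Γ] (O : Oracle (Symbol Γ)) (p : Prog V Γ) : Finite (p.Lab O) := by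
  induction p with
  | skip | push _ _ | pop _ => exact inferInstanceAs (Finite Unit)
  | seq p q hp hq => exact inferInstanceAs (Finite (p.Lab O ⊕ q.Lab O))
  | case x k h => exact inferInstanceAs (Finite (Unit ⊕ Σ o, (k o).Lab O))
  | loop x k h => exact inferInstanceAs (Finite (Fin 3 ⊕ Σ a, (k a).Lab O))
  | call x y =>
    have := O.aux.tm.ΛFin
    exact inferInstanceAs (Finite (Bool ⊕ O.aux.tm.Λ))

/-- The label at which the compiled program is entered. -/
def entry (O : Oracle (Symbol Γ)) : (p : Prog V Γ) → p.Lab O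
  | skip | push _ _ | pop _ => ()
  | seq p _ => Sum.inl (p.entry O)
  | case _ _ => Sum.inl ()
  | loop _ _ => Sum.inl 0
  | call _ _ => Sum.inl false

end Prog

/-! ### Compilation into Turing machines -/

/-- The stacks of the compiled machine: those of the program, one for each nesting depth of loops
(holding the symbols that the loop has not treated yet), one that is used for copying, those of the
oracle, and one for the output. -/
inductive StackIdx (V K : Type) (D : ℕ) : Type
  | var (v : V)
  | level (i : Fin (D + 1))
  | aux
  | sub (k : K)
  | out
  deriving DecidableEq, Fintype

section Compile

variable {V Γ : Type} (O : Oracle (Symbol Γ)) (D : ℕ)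

/-- The stack alphabets of the compiled machine. -/
abbrev StackAlphabet : StackIdx V O.aux.tm.K D → Type
  | .var _ | .level _ | .aux => Symbol Γ
  | .sub k => O.aux.tm.Γ k
  | .out => Bool

/-- The internal states of the compiled machine: a buffer for one symbol, and a state of the
oracle. -/
abbrev MachineState : Type := Option (Symbol Γ) × O.aux.tm.σ

/-- The statements of the compiled machine. -/
abbrev MachineStmt (V : Type) (Λ : Type) : Type :=
  TM2.Stmt (StackAlphabet (V := V) O D) Λ (MachineState O)

/-- The configurations of the compiled machine. -/
abbrev MachineCfg (V : Type) (Λ : Type) : Type :=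
  TM2.Cfg (StackAlphabet (V := V) O D) Λ (MachineState O)

variable {O D} in
/-- Embeds a statement of the oracle into the compiled machine. -/
def liftStmt {Λ : Type} (emb : O.aux.tm.Λ → Λ) (exit : Λ) :
    TM2.Stmt O.aux.tm.Γ O.aux.tm.Λ O.aux.tm.σ → MachineStmt O D V Λ
  | .push k f q => .push (.sub k) (fun s => f s.2) (liftStmt emb exit q)
  | .peek k f q => .peek (.sub k) (fun s o => (s.1, f s.2 o)) (liftStmt emb exit q)
  | .pop k f q => .pop (.sub k) (fun s o => (s.1, f s.2 o)) (liftStmt emb exit q)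
  | .load f q => .load (fun s => (s.1, f s.2)) (liftStmt emb exit q)
  | .branch f q₁ q₂ => .branch (fun s => f s.2) (liftStmt emb exit q₁) (liftStmt emb exit q₂)
  | .goto f => .goto fun s => emb (f s.2)
  | .halt => .goto fun _ => exit

/-- The compiled program, with its labels embedded by `emb` into those of the whole machine;
`exit` is the label to which control is passed at the end, and `d` the number of enclosing loops.

A loop first moves its stack to the copying stack (label `0`), then back and at the same time to the
loop stack of level `d` (label `1`), and then runs its body for the symbols on the loop stack
(label `2`). A call moves its stack to the input stack of the oracle (label `false`), runs the
oracle with its halting statements replaced by jumps, and finally fetches the answer (label `true`),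
which leaves all stacks of the oracle empty. -/
def Prog.code {Λ : Type} : (p : Prog V Γ) → (d : ℕ) → (emb : p.Lab O → Λ) → (exit : Λ) →
    p.Lab O → MachineStmt O D V Λ
  | .skip, _, _, exit => fun _ => .goto fun _ => exit
  | .push x a, _, _, exit => fun _ => .push (.var x) (fun _ => a) (.goto fun _ => exit)
  | .pop x, _, _, exit => fun _ => .pop (.var x) (fun s _ => s) (.goto fun _ => exit)
  | .seq p q, d, emb, exit => fun l => match l with
    | .inl l => p.code d (fun l => emb (.inl l)) (emb (.inr (q.entry O))) l
    | .inr l => q.code d (fun l => emb (.inr l)) exit l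
  | .case x k, d, emb, exit => fun l => match l with
    | .inl _ => .peek (.var x) (fun s o => (o, s.2))
        (.goto fun s => emb (.inr ⟨s.1, (k s.1).entry O⟩))
    | .inr ⟨o, l⟩ => (k o).code d (fun l => emb (.inr ⟨o, l⟩)) exit l
  | .loop x k, d, emb, exit => fun l => match l with
    | .inl 0 => .pop (.var x) (fun s o => (o, s.2)) <| .branch (fun s => s.1.isSome)
        (.push .aux (fun s => s.1.getD .endmark) (.goto fun _ => emb (.inl 0)))
        (.goto fun _ => emb (.inl 1))
    | .inl 1 => .pop .aux (fun s o => (o, s.2)) <| .branch (fun s => s.1.isSome)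
        (.push (.var x) (fun s => s.1.getD .endmark)
          (.push (.level (Fin.ofNat (D + 1) d)) (fun s => s.1.getD .endmark)
            (.goto fun _ => emb (.inl 1))))
        (.goto fun _ => emb (.inl 2))
    | .inl 2 => .pop (.level (Fin.ofNat (D + 1) d)) (fun s o => (o, s.2)) <| .goto fun s =>
        match s.1 with
        | none => exit
        | some a => emb (.inr ⟨a, (k a).entry O⟩)
    | .inr ⟨a, l⟩ => (k a).code (d + 1) (fun l => emb (.inr ⟨a, l⟩)) (emb (.inl 2)) l
  | .call x y, _, emb, exit => fun l => match l with
    | .inl false => .pop (.var x) (fun s o => (o, s.2)) <| .branch (fun s => s.1.isSome)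
        (.push (.sub O.aux.tm.k₀)
          (fun s => O.aux.inputAlphabet.invFun (s.1.getD .endmark))
          (.goto fun _ => emb (.inl false)))
        (.goto fun _ => emb (.inr O.aux.tm.main))
    | .inl true => .pop (.sub O.aux.tm.k₁)
        (fun s o => (o.map fun b => Symbol.bit (O.aux.outputAlphabet b), s.2)) <|
        .push (.var y) (fun s => s.1.getD .endmark) (.goto fun _ => exit)
    | .inr l => liftStmt (fun l => emb (.inr l)) (emb (.inl true)) (O.aux.tm.m l)

variable {O D}

/-- The stacks of the compiled machine, given the store of the program, the stacks of the
enclosing loops, the copying stack, and the stacks of the oracle. -/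
def allStacks (S : Prog.Store V Γ) (L : Fin (D + 1) → List (Symbol Γ)) (w : List (Symbol Γ))
    (Z : ∀ k, List (O.aux.tm.Γ k)) : ∀ i, List (StackAlphabet (V := V) O D i)
  | .var v => S v
  | .level i => L i
  | .aux => w
  | .sub k => Z k
  | .out => []

section Update

variable [DecidableEq V] (S : Prog.Store V Γ) (L : Fin (D + 1) → List (Symbol Γ))
  (w : List (Symbol Γ)) (Z : ∀ k, List (O.aux.tm.Γ k))

@[simp]
theorem update_stacks_var (v : V) (u : List (Symbol Γ)) :
    update (allStacks (O := O) S L w Z) (.var v) u = allStacks (update S v u) L w Z := by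
  funext i
  cases i with
  | var v' =>
    by_cases h : v' = v
    · subst h; simp [allStacks]
    · simp [allStacks, h]
  | _ => simp [allStacks]

@[simp]
theorem update_stacks_level (j : Fin (D + 1)) (u : List (Symbol Γ)) :
    update (allStacks (O := O) S L w Z) (.level j) u = allStacks S (update L j u) w Z := by
  funext i
  cases i with
  | level v' =>
    by_cases h : v' = j
    · subst h; simp [allStacks]
    · simp [allStacks, h]
  | _ => simp [allStacks]

@[simp]
theorem update_stacks_aux (u : List (Symbol Γ)) :
    update (allStacks (O := O) S L w Z) .aux u = allStacks S L u Z := by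
  funext i
  cases i <;> simp [allStacks]

@[simp]
theorem update_stacks_sub (k : O.aux.tm.K) (u : List (O.aux.tm.Γ k)) :
    update (allStacks (O := O) S L w Z) (.sub k) u = allStacks S L w (update Z k u) := by
  funext i
  cases i with
  | sub v' =>
    by_cases h : v' = k
    · subst h; simp [allStacks]
    · simp [allStacks, h]
  | _ => simp [allStacks]

end Update

/-- `Within m c c' n`: the machine `m` gets from `c` to `c'` in at most `n` steps. -/
def Within {C : Type} (m : C → Option C) (c c' : C) (n : ℕ) : Prop :=
  ∃ k ≤ n, (flip bind m)^[k] (some c) = some c'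

namespace Within

variable {C : Type} {m : C → Option C} {c c₁ c₂ : C} {n n₁ n₂ : ℕ}

theorem refl (n : ℕ) : Within m c c n := ⟨0, n.zero_le, rfl⟩

theorem trans (h₁ : Within m c c₁ n₁) (h₂ : Within m c₁ c₂ n₂) : Within m c c₂ (n₁ + n₂) := by
  obtain ⟨k₁, hk₁, e₁⟩ := h₁
  obtain ⟨k₂, hk₂, e₂⟩ := h₂
  exact ⟨k₂ + k₁, by omega, by rw [iterate_add_apply, e₁, e₂]⟩

theorem single (h : m c = some c') : Within m c c' 1 := ⟨1, le_rfl, h⟩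

theorem head (h : m c = some c₁) (h₂ : Within m c₁ c₂ n) : Within m c c₂ (1 + n) :=
  (single h).trans h₂

theorem mono (h : Within m c c₁ n₁) (hn : n₁ ≤ n₂) : Within m c c₁ n₂ :=
  let ⟨k, hk, e⟩ := h
  ⟨k, hk.trans hn, e⟩

end Within

/-- A step of the oracle is simulated by the step of the compiled machine. -/
theorem stepAux_liftStmt [DecidableEq V] {Λ : Type} (emb : O.aux.tm.Λ → Λ) (exit : Λ)
    (q : TM2.Stmt O.aux.tm.Γ O.aux.tm.Λ O.aux.tm.σ) (r : Option (Symbol Γ)) (s : O.aux.tm.σ)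
    (S : Prog.Store V Γ) (L : Fin (D + 1) → List (Symbol Γ)) (w : List (Symbol Γ))
    (Z : ∀ k, List (O.aux.tm.Γ k)) :
    TM2.stepAux (liftStmt emb exit q) (r, s) (allStacks S L w Z) =
      ⟨some (((TM2.stepAux q s Z).l.map emb).getD exit), (r, (TM2.stepAux q s Z).var),
        allStacks S L w (TM2.stepAux q s Z).stk⟩ := by
  induction q generalizing s Z with
  | push k f q ih => simp only [liftStmt, TM2.stepAux, update_stacks_sub]; exact ih _ _
  | peek k f q ih => simp only [liftStmt, TM2.stepAux]; exact ih _ _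
  | pop k f q ih => simp only [liftStmt, TM2.stepAux, update_stacks_sub]; exact ih _ _
  | load f q ih => simp [liftStmt, ih]
  | branch f q₁ q₂ ih₁ ih₂ =>
    simp only [liftStmt, TM2.stepAux]
    cases f s
    · simpa using ih₂ s Z
    · simpa using ih₁ s Z
  | goto f => simp [liftStmt]
  | halt => simp [liftStmt]

end Compile
end TeamSemantics

namespace TeamSemantics

open Turing Function

/-! ### Correctness of the compiler -/

section Compile

variable {V Γ : Type} {O : Oracle (Symbol Γ)} {D : ℕ} [DecidableEq V]

theorem initList_stk (tm : FinTM2) (u : List (tm.Γ tm.k₀)) :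
    (initList tm u).stk = update (fun _ => []) tm.k₀ u := by
  funext k
  by_cases h : k = tm.k₀
  · subst h; simp [initList]
  · simp [initList, h]

theorem haltList_stk (tm : FinTM2) (u : List (tm.Γ tm.k₁)) :
    (haltList tm u).stk = update (fun _ => []) tm.k₁ u := by
  funext k
  by_cases h : k = tm.k₁
  · subst h; simp [haltList]
  · simp [haltList, h]

variable {Λ : Type} {m : Λ → MachineStmt O D V Λ}

/-- The run of the oracle is simulated by the compiled machine. -/
theorem within_liftStmt {emb : O.aux.tm.Λ → Λ} {exit : Λ}
    (hm : ∀ l, m (emb l) = liftStmt emb exit (O.aux.tm.m l)) (r : Option (Symbol Γ))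
    (S : Prog.Store V Γ) (L : Fin (D + 1) → List (Symbol Γ)) (w : List (Symbol Γ)) (n : ℕ)
    (c c' : O.aux.tm.Cfg) (h : (flip bind O.aux.tm.step)^[n] (some c) = some c') :
    Within (TM2.step m) ⟨some ((c.l.map emb).getD exit), (r, c.var), allStacks S L w c.stk⟩
      ⟨some ((c'.l.map emb).getD exit), (r, c'.var), allStacks S L w c'.stk⟩ n := by
  induction n generalizing c with
  | zero =>
    obtain rfl : c = c' := by simpa using h
    exact Within.refl _
  | succ n ih =>
    rw [iterate_succ_apply] at h
    obtain ⟨l, s, Z⟩ := c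
    cases l with
    | none =>
      -- a halted oracle makes no further step, so that it cannot get to `c'`
      have hn : ∀ n, (flip bind O.aux.tm.step)^[n] none = none := fun n => by
        induction n with
        | zero => rfl
        | succ n ih => rw [iterate_succ_apply]; exact ih
      have : (flip bind O.aux.tm.step)^[n] none = some c' := h
      rw [hn] at this
      cases this
    | some l =>
      have h' : (flip bind O.aux.tm.step)^[n] (some (TM2.stepAux (O.aux.tm.m l) s Z)) = some c' := h
      rw [add_comm]
      refine Within.head ?_ (ih _ h')
      simp only [Option.map_some, Option.getD_some, TM2.step, hm, stepAux_liftStmt]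

/-- The configurations that the compiled machine goes through between two instructions. -/
abbrev machineCfg (l : Λ) (r : Option (Symbol Γ)) (S : Prog.Store V Γ)
    (L : Fin (D + 1) → List (Symbol Γ)) (w : List (Symbol Γ))
    (Z : ∀ k, List (O.aux.tm.Γ k)) : MachineCfg O D V Λ :=
  ⟨some l, (r, O.aux.tm.initialState), allStacks S L w Z⟩

/-- A loop that moves a stack to the copying stack. -/
theorem within_move_to_aux {l l' : Λ} {x : V}
    (hl : m l = .pop (.var x) (fun s o => (o, s.2)) (.branch (fun s => s.1.isSome)
      (.push .aux (fun s => s.1.getD .endmark) (.goto fun _ => l)) (.goto fun _ => l')))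
    (r : Option (Symbol Γ)) (S : Prog.Store V Γ) (L : Fin (D + 1) → List (Symbol Γ))
    (u w : List (Symbol Γ)) (Z : ∀ k, List (O.aux.tm.Γ k)) (hu : S x = u) :
    Within (TM2.step m) (machineCfg l r S L w Z)
      (machineCfg l' none (update S x []) L (u.reverse ++ w) Z) (u.length + 1) := by
  induction u generalizing r S w with
  | nil => exact Within.single (by simp [hl, hu, allStacks])
  | cons a u ih =>
    have := ih (some a) (update S x u) (a :: w) (by simp)
    rw [update_idem] at this
    have h := Within.head (m := TM2.step m) (c := machineCfg l r S L w Z) (by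
      simp [hl, hu, allStacks]) this
    simpa [add_comm] using h

/-- A loop that moves the copying stack back, and to another stack at the same time. -/
theorem within_move_from_aux {l l' : Λ} {x : V} {j : Fin (D + 1)}
    (hl : m l = .pop .aux (fun s o => (o, s.2)) (.branch (fun s => s.1.isSome)
      (.push (.var x) (fun s => s.1.getD .endmark)
        (.push (.level j) (fun s => s.1.getD .endmark) (.goto fun _ => l))) (.goto fun _ => l')))
    (r : Option (Symbol Γ)) (S : Prog.Store V Γ) (L : Fin (D + 1) → List (Symbol Γ))
    (w : List (Symbol Γ)) (Z : ∀ k, List (O.aux.tm.Γ k)) :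
    Within (TM2.step m) (machineCfg l r S L w Z)
      (machineCfg l' none (update S x (w.reverse ++ S x)) (update L j (w.reverse ++ L j)) [] Z)
      (w.length + 1) := by
  induction w generalizing r S L with
  | nil => exact Within.single (by simp [hl, allStacks])
  | cons a w ih =>
    have := ih (some a) (update S x (a :: S x)) (update L j (a :: L j))
    simp only [update_idem, update_self] at this
    have h := Within.head (m := TM2.step m) (c := machineCfg l r S L (a :: w) Z) (by
      simp [hl, allStacks]) this
    simpa [add_comm] using h

/-- A loop that moves a stack to the input stack of the oracle. -/
theorem within_move_to_sub {l l' : Λ} {x : V}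
    (hl : m l = .pop (.var x) (fun s o => (o, s.2)) (.branch (fun s => s.1.isSome)
      (.push (.sub O.aux.tm.k₀)
        (fun s => O.aux.inputAlphabet.invFun (s.1.getD .endmark)) (.goto fun _ => l))
      (.goto fun _ => l')))
    (r : Option (Symbol Γ)) (S : Prog.Store V Γ) (L : Fin (D + 1) → List (Symbol Γ))
    (u w : List (Symbol Γ)) (v : List (O.aux.tm.Γ O.aux.tm.k₀)) (hu : S x = u) :
    Within (TM2.step m) (machineCfg l r S L w (update (fun _ => []) O.aux.tm.k₀ v))
      (machineCfg l' none (update S x []) L w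
        (update (fun _ => []) O.aux.tm.k₀ (u.reverse.map O.aux.inputAlphabet.invFun ++ v)))
      (u.length + 1) := by
  induction u generalizing r S v with
  | nil => exact Within.single (by simp [hl, hu, allStacks])
  | cons a u ih =>
    have := ih (some a) (update S x u) (O.aux.inputAlphabet.invFun a :: v) (by simp)
    rw [update_idem] at this
    have h := Within.head (m := TM2.step m)
      (c := machineCfg l r S L w (update (fun _ => []) O.aux.tm.k₀ v)) (by
      simp [hl, hu, allStacks]) this
    simpa [add_comm] using h

theorem eval_le_eval (p : Polynomial ℕ) {a b : ℕ} (h : a ≤ b) : p.eval a ≤ p.eval b := by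
  simp only [Polynomial.eval_eq_sum, Polynomial.sum]
  gcongr

open Polynomial in
/-- Compilation is correct: the compiled program does what the weakest precondition says, in a
number of steps that is bounded by `Prog.cost`. -/
theorem code_correct [Finite Γ] {B : ℕ} (p : Prog V Γ) {Λ : Type} {m : Λ → MachineStmt O D V Λ}
    {d : ℕ} {emb : p.Lab O → Λ} {exit : Λ} (hm : ∀ l, m (emb l) = p.code O D d emb exit l)
    (hd : d + p.depth ≤ D) {S : Prog.Store V Γ} {L : Fin (D + 1) → List (Symbol Γ)}
    (hL : ∀ i, d ≤ i.val → L i = []) {Q : Prog.Store V Γ → Prop} (h : p.wp O B Q S)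
    (r : Option (Symbol Γ)) :
    ∃ S' r', Q S' ∧ Within (TM2.step m) (machineCfg (emb (p.entry O)) r S L [] fun _ => [])
      (machineCfg exit r' S' L [] fun _ => []) ((p.cost O).eval B) := by
  induction p generalizing d S L Q r exit with
  | skip =>
    refine ⟨S, r, h, Within.single ?_ |>.mono (by simp [Prog.cost])⟩
    simp [hm, Prog.code]
  | push x a =>
    refine ⟨_, r, h, Within.single ?_ |>.mono (by simp [Prog.cost])⟩
    simp [hm, Prog.code, allStacks]
  | pop x =>
    refine ⟨_, r, h, Within.single ?_ |>.mono (by simp [Prog.cost])⟩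
    simp [hm, Prog.code, allStacks]
  | seq p q hp hq =>
    simp only [Prog.depth] at hd
    obtain ⟨S₁, r₁, h₁, w₁⟩ := hp (emb := fun l => emb (.inl l))
      (fun l => (hm (.inl l)).trans (by rw [Prog.code])) (by omega) hL h r
    obtain ⟨S₂, r₂, h₂, w₂⟩ := hq (emb := fun l => emb (.inr l))
      (fun l => (hm (.inr l)).trans (by rw [Prog.code])) (by omega) hL h₁ r₁
    exact ⟨S₂, r₂, h₂, (w₁.trans w₂).mono (by simp [Prog.cost])⟩
  | case x k ih =>
    have hk : (k (S x).head?).depth ≤ Prog.depth (.case x k) := by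
      simp only [Prog.depth]
      exact Finset.le_sup (f := fun o => (k o).depth) (Finset.mem_univ _)
    obtain ⟨S₁, r₁, h₁, w₁⟩ := ih (S x).head?
      (emb := fun l => emb (.inr ⟨_, l⟩)) (fun l => (hm (.inr ⟨_, l⟩)).trans (by rw [Prog.code]))
      (by omega) hL h (S x).head?
    refine ⟨S₁, r₁, h₁, (Within.head ?_ w₁).mono ?_⟩
    · have e : m (emb (Prog.entry O (.case x k))) = .peek (.var x) (fun s o => (o, s.2))
          (.goto fun s => emb (.inr ⟨s.1, (k s.1).entry O⟩)) :=
        (hm (.inl ())).trans (by rw [Prog.code])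
      generalize emb (Prog.entry O (.case x k)) = l at *
      simp [e, allStacks]
    · simp only [Prog.cost, eval_add, eval_one, eval_finsetSum, add_le_add_iff_left]
      exact Finset.single_le_sum (f := fun o => ((k o).cost O).eval B)
        (fun _ _ => Nat.zero_le _) (Finset.mem_univ _)
  | loop x k ih =>
    obtain ⟨hB, h⟩ := h
    simp only [Prog.depth] at hd
    set j : Fin (D + 1) := Fin.ofNat (D + 1) d with hj
    have hjd : j.val = d := Nat.mod_eq_of_lt (by omega)
    have e : m (emb (.inl 2)) = .pop (.level j) (fun s o => (o, s.2)) (.goto fun s =>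
        match s.1 with
        | none => exit
        | some a => emb (.inr ⟨a, (k a).entry O⟩)) :=
        (hm (.inl 2)).trans (by rw [Prog.code])
    -- the label `emb (.inl 2)` is made opaque, so that `simp` does not unfold it
    obtain ⟨l₂, hl₂⟩ : ∃ l, l = emb (.inl 2) := ⟨_, rfl⟩
    rw [← hl₂] at e
    -- the iteration, with the symbols `l` that have not been treated yet on the `j`-th loop stack
    have key : ∀ (l : List (Symbol Γ)) (S : Prog.Store V Γ) (r : Option (Symbol Γ)),
        Prog.wpLoop (fun a => (k a).wp O B) l Q S →
        ∃ S' r', Q S' ∧ Within (TM2.step m)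
          (machineCfg l₂ r S (update L j l) [] fun _ => [])
          (machineCfg exit r' S' L [] fun _ => [])
          (l.length * (1 + ∑ a, ((k a).cost O).eval B) + 1) := by
      intro l
      induction l with
      | nil =>
        intro S r hQ
        refine ⟨S, none, hQ, Within.single ?_ |>.mono (by simp)⟩
        have : update L j [] = L := by
          rw [update_eq_self_iff, hL j hjd.ge]
        simp [e, allStacks]
        simp [this]
      | cons a l ihl =>
        intro S r hQ
        have hk : (k a).depth ≤ Finset.univ.sup fun a => (k a).depth :=
          Finset.le_sup (f := fun o => (k o).depth) (Finset.mem_univ _)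
        obtain ⟨S₁, r₁, h₁, w₁⟩ := ih a
          (emb := fun l => emb (.inr ⟨a, l⟩)) (exit := l₂)
          (fun l => by rw [hl₂]; exact (hm (.inr ⟨a, l⟩)).trans (by rw [Prog.code]))
          (d := d + 1) (by omega) (L := update L j l) (fun i hi => by
            rw [update_of_ne (by rintro rfl; omega)]
            exact hL i (by omega)) hQ (some a)
        obtain ⟨S₂, r₂, h₂, w₂⟩ := ihl S₁ r₁ h₁
        have hc : ((k a).cost O).eval B ≤ ∑ a, ((k a).cost O).eval B :=
          Finset.single_le_sum (f := fun o => ((k o).cost O).eval B)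
            (fun _ _ => Nat.zero_le _) (Finset.mem_univ _)
        refine ⟨S₂, r₂, h₂, (Within.head ?_ (w₁.trans w₂)).mono ?_⟩
        · simp [e, allStacks]
        · rw [List.length_cons, Nat.succ_mul]
          omega
    obtain ⟨S₁, r₁, h₁, w₁⟩ := key (S x) S none h
    refine ⟨S₁, r₁, h₁, ?_⟩
    have w₂ := within_move_to_aux (m := m) (l := emb (.inl 0)) (l' := emb (.inl 1))
      ((hm (.inl 0)).trans (by rw [Prog.code])) r S L (S x) [] (fun _ => []) rfl
    have w₃ := within_move_from_aux (m := m) (l := emb (.inl 1)) (l' := l₂) (j := j)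
      (by rw [hl₂]; exact (hm (.inl 1)).trans (by rw [Prog.code])) none (update S x []) L
      (S x).reverse (fun _ => [])
    simp only [update_idem, update_self, List.append_nil, List.reverse_reverse,
      update_eq_self, hL j hjd.ge] at w₂ w₃
    refine ((w₂.trans w₃).trans w₁).mono ?_
    simp only [Prog.cost, eval_add, eval_mul, eval_X, eval_one, eval_finsetSum, eval_ofNat,
      List.length_reverse]
    have := Nat.mul_le_mul_right (1 + ∑ a, ((k a).cost O).eval B) hB
    omega
  | call x y =>
    obtain ⟨hB, b, hb, hQ⟩ := h
    obtain ⟨⟨⟨n, hn⟩, hle⟩⟩ := O.correct _ _ hb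
    have hle : n ≤ O.time.eval (S x).length := by simpa using hle
    refine ⟨_, some (.bit b), hQ, ?_⟩
    -- the question is moved to the oracle, the oracle runs, and the answer is fetched
    have w₁ := within_move_to_sub (m := m) (l := emb (.inl false))
      (l' := emb (.inr O.aux.tm.main)) ((hm (.inl false)).trans (by rw [Prog.code]))
      r S L (S x) [] [] rfl
    have w₂ := within_liftStmt (m := m) (emb := fun l => emb (.inr l))
      (exit := emb (.inl true)) (fun l => (hm (.inr l)).trans (by rw [Prog.code])) none
      (update S x []) L [] n _ _ hn
    rw [initList_stk, haltList_stk] at w₂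
    simp only [initList, haltList, Option.map_some, Option.getD_some, Option.map_none,
      Option.getD_none] at w₂
    simp only [List.append_nil, update_eq_self] at w₁
    have hle' := eval_le_eval O.time hB
    refine ((w₁.trans w₂).trans (Within.single ?_)).mono (n₁ := ((S x).length + 1 + n) + 1) ?_
    · have e : m (emb (.inl true)) = .pop (.sub O.aux.tm.k₁)
          (fun s o => (o.map fun b => Symbol.bit (O.aux.outputAlphabet b), s.2))
          (.push (.var y) (fun s => s.1.getD .endmark) (.goto fun _ => exit)) :=
        (hm (.inl true)).trans (by rw [Prog.code])
      generalize emb (.inl true) = l at *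
      simp [e, allStacks, Computability.encodeBool]
    · simp only [Prog.cost, eval_add, eval_X, eval_one]
      omega

omit [DecidableEq V] in
theorem allStacks_nil :
    allStacks (V := V) (O := O) (D := D) (fun _ => []) (fun _ => []) [] (fun _ => []) =
      fun _ => [] := by
  funext i
  cases i <;> rfl

/-- The Turing machine for the program `p`: the input is on the stack `x`, and the machine finally
moves the topmost symbol of the stack `y` to the output stack. -/
noncomputable def machine [Fintype V] [Finite Γ] (O : Oracle (Symbol Γ)) (p : Prog V Γ) (x y : V) :
    TM2ComputableAux (Symbol Γ) Bool where
  tm :=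
    { K := StackIdx V O.aux.tm.K p.depth
      kFin := by have := O.aux.tm.kFin; infer_instance
      k₀ := .var x
      k₁ := .out
      Γ := StackAlphabet O p.depth
      Λ := Option (p.Lab O)
      main := some (p.entry O)
      ΛFin := by have := p.finite_lab O; exact Fintype.ofFinite _
      σ := MachineState O
      initialState := (none, O.aux.tm.initialState)
      σFin := by have := O.aux.tm.σFin; infer_instance
      Γk₀Fin := inferInstanceAs (Fintype (Symbol Γ))
      m := fun l => match l with
        | some l => p.code O p.depth 0 some none l
        | none => .pop (.var y) (fun s o => (o, s.2)) <|
            .push .out (fun s => match s.1 with | some (.bit b) => b | _ => false) <|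
            .load (fun s => (none, s.2)) .halt }
  inputAlphabet := Equiv.refl _
  outputAlphabet := Equiv.refl _

/-- The machine for a program that is correct for the input `w` outputs the answer, in a time that
is polynomial in the bound `B` for the stacks. -/
theorem machine_outputsInTime [Fintype V] [Finite Γ] {B : ℕ} {p : Prog V Γ} {x y : V}
    {w : List (Symbol Γ)} {b : Bool}
    (h : p.wp O B (fun S => S = update (fun _ => []) y [.bit b]) (update (fun _ => []) x w)) :
    Nonempty (TM2OutputsInTime (machine O p x y).tm
      (w.map (machine O p x y).inputAlphabet.invFun)
      (some ((Computability.encodeBool b).map (machine O p x y).outputAlphabet.invFun))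
      ((p.cost O).eval B + 1)) := by
  obtain ⟨S', r', rfl, w₁⟩ := code_correct p (D := p.depth) (m := (machine O p x y).tm.m) (d := 0)
    (emb := some) (exit := none) (fun l => rfl) (by omega) (L := fun _ => []) (by simp) h none
  have hs : initList (machine O p x y).tm (w.map (machine O p x y).inputAlphabet.invFun) =
      machineCfg (some (p.entry O)) none (update (fun _ => []) x w) (fun _ => []) []
        fun _ => [] := by
    refine (TM2.Cfg.mk.injEq ..).mpr ⟨rfl, rfl, ?_⟩
    refine (initList_stk _ _).trans ?_
    rw [← update_stacks_var, allStacks_nil]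
    exact congrArg _ (List.map_id w)
  have he : TM2.step (machine O p x y).tm.m (machineCfg none r' (update (fun _ => []) y [.bit b])
      (fun _ => []) [] fun _ => []) = some (haltList (machine O p x y).tm
        ((Computability.encodeBool b).map (machine O p x y).outputAlphabet.invFun)) := by
    refine congrArg some ((TM2.Cfg.mk.injEq ..).mpr ⟨rfl, rfl, ?_⟩)
    refine Eq.trans ?_ (haltList_stk _ _).symm
    have e₁ : update (allStacks (O := O) (D := p.depth) (update (fun _ => []) y [.bit b])
        (fun _ => []) [] fun _ => []) (.var y) [] = fun _ => [] := by
      rw [update_stacks_var, update_idem, update_eq_self_iff.mpr rfl, allStacks_nil]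
    have e₂ : allStacks (O := O) (D := p.depth) (update (fun _ => []) y [.bit b])
        (fun _ => []) [] (fun _ => []) (.var y) = [.bit b] := by
      simp [allStacks]
    change update (update (allStacks _ _ _ _) (.var y) _) .out _ = _
    rw [e₂]
    exact congrArg (fun Z : ∀ i, List (StackAlphabet (V := V) O p.depth i) =>
      update Z .out (b :: Z .out)) e₁
  obtain ⟨k, hk, e⟩ := w₁.trans (Within.single he)
  exact ⟨⟨⟨k, by rw [hs]; exact e⟩, hk⟩⟩

end Compile
end TeamSemantics

namespace TeamSemantics

open Function

/-! ### Basic programs and their specifications -/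

namespace Prog

variable {V Γ : Type} [DecidableEq V]

/-- `p.Runs O B S S'`: the program `p` leads from the store `S` to the store `S'`, and keeps to the
bound `B`. -/
def Runs (O : Oracle (Symbol Γ)) (B : ℕ) (p : Prog V Γ) (S S' : Store V Γ) : Prop :=
  ∀ Q : Store V Γ → Prop, Q S' → p.wp O B Q S

/-- Sequential composition of a list of programs. -/
def block : List (Prog V Γ) → Prog V Γ
  | [] => skip
  | p :: ps => seq p (block ps)

/-- Empties the stack `x`. -/
def clear (x : V) : Prog V Γ := loop x fun _ => pop x

/-- Replaces every symbol of `x`, from the top downwards, by a word that is pushed to `y`; the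
stack `x` is kept. -/
def translate (x y : V) (g : Symbol Γ → List (Symbol Γ)) : Prog V Γ :=
  loop x fun a => block ((g a).map (push y))

/-- Pushes the symbols of `x`, from the top downwards, to `y`; the stack `x` is kept. -/
def pour (x y : V) : Prog V Γ := translate x y fun a => [a]

/-- Branches on whether there is a bit `1` on top of the stack `x`. -/
def ifTrue (x : V) (p q : Prog V Γ) : Prog V Γ :=
  case x fun o => match o with
    | some (.bit true) => p
    | _ => q

/-- Runs `body` for every word in the list of words on the stack `x`; in the body, the
reversed word is on the stack `w`. -/
def forWords (x w : V) (body : Prog V Γ) : Prog V Γ :=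
  loop x fun a => match a with
    | .endmark => block [body, clear w]
    | a => push w a

open Classical in
/-- Moves the symbols above the topmost `sep` from the stack `x` to the stack `y`, and removes this
`sep`. The stack `flag` is used for a flag that is set when `sep` has been found. -/
noncomputable def popUntil (sep : Symbol Γ) (x y flag : V) : Prog V Γ :=
  block [loop x fun a => case flag fun o => match o with
      | none => block [pop x, if a = sep then push flag .top else push y a]
      | some _ => skip,
    pop flag]

variable {O : Oracle (Symbol Γ)} {B : ℕ} {S S' S₁ S₂ : Store V Γ} {p q : Prog V Γ}

namespace Runs

theorem congr (h : p.Runs O B S S₁) (e : S₁ = S₂) : p.Runs O B S S₂ := e ▸ h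

theorem of_eq (e : S = S') : (skip : Prog V Γ).Runs O B S S' := fun _ h => e ▸ h

theorem nil (e : S = S') : (block [] : Prog V Γ).Runs O B S S' := of_eq e

theorem cons {ps : List (Prog V Γ)} (h : p.Runs O B S S₁) (hs : (block ps).Runs O B S₁ S₂) :
    (block (p :: ps)).Runs O B S S₂ := fun Q hQ => h _ (hs Q hQ)

theorem push (x : V) (a : Symbol Γ) : (push x a).Runs O B S (update S x (a :: S x)) :=
  fun _ h => h

theorem pop (x : V) : (pop x : Prog V Γ).Runs O B S (update S x (S x).tail) := fun _ h => h

theorem case {x : V} {k : Option (Symbol Γ) → Prog V Γ} {o : Option (Symbol Γ)}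
    (ho : (S x).head? = o) (h : (k o).Runs O B S S') : (case x k).Runs O B S S' :=
  fun Q hQ => by subst ho; exact h Q hQ

theorem ifTrue {x : V} (hp : (S x).head? = some (.bit true) → p.Runs O B S S')
    (hq : (S x).head? ≠ some (.bit true) → q.Runs O B S S') : (ifTrue x p q).Runs O B S S' := by
  refine case rfl ?_
  by_cases h : (S x).head? = some (.bit true)
  · rw [h]; exact hp h
  · split
    · contradiction
    · exact hq h

/-- A loop is described by giving the store `T pre` after the symbols in `pre` have
been treated. -/
theorem loop {x : V} {k : Symbol Γ → Prog V Γ} (T : List (Symbol Γ) → Store V Γ)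
    (hB : (S x).length ≤ B) (h₀ : T [] = S)
    (h : ∀ pre a suf, S x = pre ++ a :: suf → (k a).Runs O B (T pre) (T (pre ++ [a]))) :
    (loop x k).Runs O B S (T (S x)) := by
  intro Q hQ
  refine ⟨hB, ?_⟩
  have key : ∀ suf pre, S x = pre ++ suf → wpLoop (fun a => (k a).wp O B) suf Q (T pre) := by
    intro suf
    induction suf with
    | nil =>
      intro pre e
      rw [List.append_nil] at e
      exact e ▸ hQ
    | cons a suf ih =>
      intro pre e
      exact h pre a suf e _ (ih (pre ++ [a]) (by simpa using e))
  exact h₀ ▸ key (S x) [] rfl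

theorem clear {x : V} (hB : (S x).length ≤ B) : (clear x).Runs O B S (update S x []) := by
  refine (loop (fun pre => update S x ((S x).drop pre.length)) hB (by simp)
    fun pre a suf e => ?_).congr (by simp)
  refine (pop x).congr ?_
  simp

theorem pushes (y : V) (l : List (Symbol Γ)) :
    (block (l.map (Prog.push y))).Runs O B S (update S y (l.reverse ++ S y)) := by
  induction l generalizing S with
  | nil => exact nil (by simp)
  | cons a l ih => exact cons (push _ _) (ih.congr (by simp))

theorem translate {x y : V} {g : Symbol Γ → List (Symbol Γ)} (hB : (S x).length ≤ B) :
    (translate x y g).Runs O B S (update S y (((S x).flatMap g).reverse ++ S y)) := by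
  refine loop (fun pre => update S y ((pre.flatMap g).reverse ++ S y)) hB (by simp)
    fun pre a suf e => ?_
  exact (pushes y _).congr (by simp)

theorem pour {x y : V} (hB : (S x).length ≤ B) :
    (pour x y).Runs O B S (update S y ((S x).reverse ++ S y)) :=
  (translate hB).congr (by simp)

theorem forWords {x w : V} {words : List (List Bool)} (T : List (List Bool) → Store V Γ)
    (hx : S x = words.flatMap encodeWord) (hB : (S x).length ≤ B) (h₀ : T [] = S)
    (hw : ∀ pre, T pre w = [])
    (h : ∀ pre u suf, words = pre ++ u :: suf →
      p.Runs O B (update (T pre) w (u.map Symbol.bit).reverse)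
        (update (T (pre ++ [u])) w (u.map Symbol.bit).reverse)) :
    (forWords x w p).Runs O B S (T words) := by
  intro Q hQ
  refine ⟨hB, ?_⟩
  have hlen : ∀ u ∈ words, u.length ≤ B := fun u hu => by
    refine le_trans ?_ hB
    rw [hx, List.length_flatMap]
    refine le_trans ?_ (List.single_le_sum (by simp) _ (List.mem_map_of_mem hu))
    simp [encodeWord]
  rw [hx]
  set f : Symbol Γ → (Store V Γ → Prop) → Store V Γ → Prop := fun a => wp O B (match a with
    | .endmark => block [p, Prog.clear w]
    | a => Prog.push w a) with hf
  have hword : ∀ (u : List Bool) l Q (S' : Store V Γ),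
      wpLoop f l Q (update S' w ((u.map Symbol.bit).reverse ++ S' w)) →
      wpLoop f (u.map Symbol.bit ++ l) Q S' := by
    intro u
    induction u with
    | nil => intro l Q S' hQ; simpa using hQ
    | cons b u ih =>
      intro l Q S' hQ
      exact ih l Q (update S' w (Symbol.bit b :: S' w)) (by simpa using hQ)
  have key : ∀ suf pre, words = pre ++ suf → wpLoop f (suf.flatMap encodeWord) Q (T pre) := by
    intro suf
    induction suf with
    | nil =>
      intro pre e
      rw [List.append_nil] at e
      exact e ▸ hQ
    | cons u suf ih =>
      intro pre e
      rw [List.flatMap_cons, encodeWord, List.append_assoc]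
      refine hword u _ Q _ ?_
      rw [hw, List.append_nil]
      have hc : (block [p, Prog.clear w]).Runs O B
          (update (T pre) w (u.map Symbol.bit).reverse) (T (pre ++ [u])) := by
        refine cons (h pre u suf e) (cons (clear ?_) (nil ?_))
        · simpa using hlen u (by simp [e])
        · rw [update_idem, update_eq_self_iff, hw]
      exact hc _ (ih (pre ++ [u]) (by simpa using e))
  exact h₀ ▸ key words [] rfl

theorem popUntil {sep : Symbol Γ} {x y flag : V} {u rest : List (Symbol Γ)} (hxy : x ≠ y)
    (hxf : x ≠ flag) (hyf : y ≠ flag) (hx : S x = u ++ sep :: rest) (hu : sep ∉ u)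
    (hy : S y = []) (hf : S flag = []) (hB : (S x).length ≤ B) :
    (popUntil sep x y flag).Runs O B S (update (update S x rest) y u.reverse) := by
  classical
  -- `T l`: the store after the symbols in `l` have been treated
  let T : List (Symbol Γ) → Store V Γ := fun l =>
    if sep ∈ l then update (update (update S x rest) y u.reverse) flag [.top]
    else update (update S x ((u ++ sep :: rest).drop l.length)) y l.reverse
  have hT : T (S x) = update (update (update S x rest) y u.reverse) flag [.top] :=
    if_pos (by simp [hx])
  refine cons (loop T hB ?_ fun pre a suf e => ?_) (cons (pop flag) (nil ?_))
  · simp only [T, List.not_mem_nil, if_false, List.length_nil, List.drop_zero, List.reverse_nil]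
    rw [← hx, update_eq_self, ← hy, update_eq_self]
  · by_cases hs : sep ∈ pre
    · refine case (o := some .top) (by simp [T, hs]) (of_eq ?_)
      simp [T, hs]
    · refine case (o := none) (by simp [T, hs, hyf.symm, hxf.symm, hf]) (cons (pop x) ?_)
      rw [hx] at e
      by_cases ha : a = sep
      · subst ha
        have hpre : u = pre ∧ rest = suf := by
          rcases List.append_eq_append_iff.mp e with ⟨c, h₁, h₂⟩ | ⟨c, h₁, h₂⟩
          · cases c with
            | nil => simp_all
            | cons d c => simp_all
          · cases c with
            | nil => simp_all
            | cons d c => simp_all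
        obtain ⟨rfl, rfl⟩ := hpre
        rw [if_pos rfl]
        refine cons (push _ _) (nil ?_)
        simp only [T, if_neg hs, List.drop_left]
        rw [if_pos (by simp)]
        funext v
        by_cases h₁ : v = x <;> by_cases h₂ : v = y <;> by_cases h₃ : v = flag <;>
          simp_all [update_apply]
      · rw [if_neg ha]
        refine cons (push _ _) (nil ?_)
        have hs' : sep ∉ pre ++ [a] := by simp [hs, Ne.symm ha]
        simp only [T, if_neg hs, if_neg hs']
        funext v
        by_cases h₁ : v = x <;> by_cases h₂ : v = y <;> simp_all [update_apply]
  · rw [hT]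
    funext v
    by_cases h₁ : v = x <;> by_cases h₂ : v = y <;> by_cases h₃ : v = flag <;>
      simp_all [update_apply]

end Runs

end Prog

end TeamSemantics

namespace TeamSemantics

open Function

/-! ### The model checking program -/

/-- The stacks of the model checking program. -/
inductive Reg : Type
  /-- the input -/
  | input
  /-- the column labels and the rows of the table -/
  | vars | rows
  /-- all sets of rows, as bit masks -/
  | masks
  /-- the evaluation stack -/
  | stack
  /-- kind and (reversed) name of the literal or atom that is being read -/
  | kind | name
  /-- a flag for `Prog.popUntil` -/
  | flag
  /-- the operands and the result of a connective or of a leaf -/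
  | vecL | vecR | vecOut
  /-- what remains of the operands while a loop runs through them -/
  | itL | itR
  /-- words that are read by loops over lists of words -/
  | mask | maskL | maskR | row | var
  /-- used for the comparison of words -/
  | z₁ | z₂ | z₃ | ok
  /-- which rows satisfy the present literal -/
  | col
  /-- a flag for successful searches -/
  | hit
  /-- the question to the oracle -/
  | arg
  | tmp
  | answer
  deriving DecidableEq

instance : Fintype Reg where
  elems := {.input, .vars, .rows, .masks, .stack, .kind, .name, .flag, .vecL, .vecR, .vecOut,
    .itL, .itR, .mask, .maskL, .maskR, .row, .var, .z₁, .z₂, .z₃, .ok, .col, .hit, .arg, .tmp,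
    .answer}
  complete x := by cases x <;> decide

open Classical in
/-- The content of a stack that holds a flag: it is empty iff `P` fails. -/
noncomputable def flagOf {Γ : Type} (P : Prop) : List (Symbol Γ) := if P then [.top] else []

namespace Prog

variable {Γ : Type}

open Classical in
/-- Sets the flag `ok` if the symbols at the same position in the words on `x₁`, `x₂`, `x₃`, read
from the bottom of the stacks, are always in the relation `R`. Positions outside of the first
word are ignored, and `none` is used for positions outside of the second or third one. -/
noncomputable def zipTest (R : Symbol Γ → Option (Symbol Γ) → Option (Symbol Γ) → Prop)
    (x₁ x₂ x₃ : Reg) : Prog Reg Γ :=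
  block [push .ok .top, pour x₁ .z₁, pour x₂ .z₂, pour x₃ .z₃,
    loop .z₁ fun c => block [case .z₂ fun o₂ => case .z₃ fun o₃ =>
      if R c o₂ o₃ then skip else clear .ok, pop .z₂, pop .z₃],
    clear .z₁, clear .z₂, clear .z₃]

/-- Branches on the outcome of `zipTest`. -/
noncomputable def ifZip (R : Symbol Γ → Option (Symbol Γ) → Option (Symbol Γ) → Prop)
    (x₁ x₂ x₃ : Reg) (p q : Prog Reg Γ) : Prog Reg Γ :=
  block [zipTest R x₁ x₂ x₃, case .ok fun o => match o with
    | none => q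
    | some _ => block [pop .ok, p]]

/-- Pushes the (reversed) word on `vecOut` to the evaluation stack. -/
def pushVec : Prog Reg Γ := block [push .stack .endmark, pour .vecOut .stack, clear .vecOut]

/-- Computes the value of a literal from the list `col` of the truth values in the rows. -/
noncomputable def flatVec : Prog Reg Γ :=
  block [forWords .masks .mask (ifZip (fun a b _ => a = .bit true → b = some (.bit true))
      .mask .col .col (push .vecOut (.bit true)) (push .vecOut (.bit false))),
    clear .col, pushVec]

/-- Assigns the truth value `b` to all rows. -/
def constCol (b : Bool) : Prog Reg Γ :=
  translate .rows .col fun a => match a with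
    | .endmark => [.bit b]
    | _ => []

/-- Runs `p` if the words on `x` and `y` are equal. -/
noncomputable def ifEq (x y : Reg) (p : Prog Reg Γ) : Prog Reg Γ :=
  ifZip (fun a b _ => b = some a) x y y (ifZip (fun a b _ => b = some a) y x x p skip) skip

/-- Computes the truth value of the literal on `name` (negated, if `b` is `false`) in all rows. -/
noncomputable def litCol (b : Bool) : Prog Reg Γ :=
  forWords .rows .row (block [pour .row .tmp,
    forWords .vars .var (block [
      ifTrue .tmp (ifEq .var .name (block [clear .hit, push .hit .top])) skip, pop .tmp]),
    clear .tmp,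
    case .hit fun o => match o with
      | none => push .col (.bit !b)
      | some _ => push .col (.bit b),
    clear .hit])

/-- Writes the question whether the team given by `mask` satisfies the atom on `name` to `arg`. -/
def writeArg : Prog Reg Γ :=
  block [pour .mask .tmp, pour .vars .arg, push .arg .bar,
    forWords .rows .row (block [
      ifTrue .tmp (block [pour .row .z₁, pour .z₁ .arg, clear .z₁, push .arg .endmark]) skip,
      pop .tmp]),
    clear .tmp, push .arg .bar, push .arg .atom, pour .name .z₁,
    pour .z₁ .arg, clear .z₁, push .arg .endmark]

/-- Computes the value of the atom on `name`. -/
def atomVec : Prog Reg Γ :=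
  block [forWords .masks .mask (block [writeArg, call .arg .vecOut]), pushVec]

/-- Takes the two topmost words, in reversed form, from the evaluation stack. -/
noncomputable def popVecs : Prog Reg Γ :=
  block [popUntil .endmark .stack .vecR .flag, popUntil .endmark .stack .vecL .flag]

/-- Computes the value of a conjunction. -/
noncomputable def andVec : Prog Reg Γ :=
  block [popVecs, pour .vecL .itL, pour .vecR .itR,
    loop .itR fun c => block [match c with
      | .bit true => ifTrue .itL (push .vecOut (.bit true)) (push .vecOut (.bit false))
      | _ => push .vecOut (.bit false), pop .itL],
    clear .itL, clear .itR, clear .vecL, clear .vecR, pushVec]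

/-- The bit `a` of a team is obtained from the bits `b` and `c` of two teams into which it
is split. -/
def splitRel : Semantics → Symbol Γ → Option (Symbol Γ) → Option (Symbol Γ) → Prop
  | .lax, a, b, c => a = .bit true ↔ b = some (.bit true) ∨ c = some (.bit true)
  | .strict, a, b, c => (a = .bit true ↔ b = some (.bit true) ∨ c = some (.bit true)) ∧
      ¬(b = some (.bit true) ∧ c = some (.bit true))

/-- Sets the flag `hit` if the masks on `mask` and `maskL` can be completed to a split by a
mask that is marked in `vecR`. -/
noncomputable def searchR (m : Semantics) : Prog Reg Γ :=
  block [pour .vecR .itR,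
    forWords .masks .maskR (block [
      ifTrue .itR (ifZip (splitRel m) .mask .maskL .maskR
        (block [clear .hit, push .hit .top]) skip) skip,
      pop .itR]),
    clear .itR]

/-- Sets the flag `hit` if the mask on `mask` can be split into a mask that is marked in `vecL`
and a mask that is marked in `vecR`. -/
noncomputable def searchL (m : Semantics) : Prog Reg Γ :=
  block [pour .vecL .itL,
    forWords .masks .maskL (block [ifTrue .itL (searchR m) skip, pop .itL]),
    clear .itL]

/-- Computes the value of a disjunction, by trying all pairs of masks for each mask. -/
noncomputable def orVec (m : Semantics) : Prog Reg Γ :=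
  block [popVecs,
    forWords .masks .mask (block [searchL m,
      case .hit fun o => match o with
        | none => push .vecOut (.bit false)
        | some _ => push .vecOut (.bit true),
      clear .hit]),
    clear .vecL, clear .vecR, pushVec]

/-- Treats one symbol of the formula. -/
noncomputable def token (m : Semantics) : Symbol Γ → Prog Reg Γ
  | .top => block [constCol true, flatVec]
  | .bot => block [constCol false, flatVec]
  | .pos => push .kind .pos
  | .neg => push .kind .neg
  | .atom => push .kind .atom
  | .bit b => push .name (.bit b)
  | .chr g => push .name (.chr g)
  | .bar => skip
  | .and => andVec
  | .or => orVec m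
  | .endmark => block [case .kind fun o => match o with
      | some .pos => block [litCol true, flatVec]
      | some .neg => block [litCol false, flatVec]
      | _ => atomVec, clear .kind, clear .name]

/-- Inserts the bit `b` at the end of a word. -/
def appendBit (b : Bool) : Symbol Γ → List (Symbol Γ)
  | .endmark => [.bit b, .endmark]
  | a => [a]

/-- Replaces every mask by its two extensions by a further bit. -/
def doubleMasks : Prog Reg Γ :=
  block [translate .masks .tmp (appendBit true), translate .masks .tmp (appendBit false),
    clear .masks, pour .tmp .masks, clear .tmp]

/-- Writes all masks, the one that selects all rows first. -/
def writeMasks : Prog Reg Γ :=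
  block [push .masks .endmark, forWords .rows .row doubleMasks]

/-- Moves the column labels and the rows of the table to their stacks. -/
noncomputable def readTable : Prog Reg Γ :=
  block [popUntil .bar .input .tmp .flag, pour .tmp .vars, clear .tmp,
    popUntil .bar .input .tmp .flag, pour .tmp .rows, clear .tmp]

/-- The model checking program. -/
noncomputable def modelCheck (m : Semantics) : Prog Reg Γ :=
  block [readTable, writeMasks, loop .input (token m),
    ifTrue .stack (push .answer (.bit true)) (push .answer (.bit false)),
    clear .input, clear .vars, clear .rows, clear .masks, clear .stack]

/-! ### Correctness of the parts of the program -/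

variable {O : Oracle (Symbol Γ)} {B : ℕ} {S S' : Store Reg Γ} {p q : Prog Reg Γ}

theorem forall_getElem?_concat {α : Type} {l : List α} {a : α} {P : ℕ → α → Prop} :
    (∀ i c, (l ++ [a])[i]? = some c → P i c) ↔
      (∀ i c, l[i]? = some c → P i c) ∧ P l.length a := by
  constructor
  · refine fun h => ⟨fun i c hc => h i c ?_, h _ _ (by simp)⟩
    rw [List.getElem?_append_left (List.getElem?_eq_some_iff.mp hc).1, hc]
  · rintro ⟨h₁, h₂⟩ i c hc
    rcases lt_trichotomy i l.length with hi | rfl | hi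
    · exact h₁ i c (by rwa [List.getElem?_append_left hi] at hc)
    · simp only [List.getElem?_concat_length, Option.some.injEq] at hc
      exact hc ▸ h₂
    · rw [List.getElem?_eq_none (by simp; omega)] at hc
      cases hc

/-- The condition that is decided by `zipTest`, about the words read from the bottom. -/
def ZipRel (R : Symbol Γ → Option (Symbol Γ) → Option (Symbol Γ) → Prop)
    (l₁ l₂ l₃ : List (Symbol Γ)) : Prop :=
  ∀ (i : ℕ) c, l₁[i]? = some c → R c l₂[i]? l₃[i]?

/-- The loop over the first word keeps the unread parts of the other two words on `z₂` and `z₃`,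
and in `ok` whether the relation holds up to the present position. -/
theorem Runs.zipTest {R : Symbol Γ → Option (Symbol Γ) → Option (Symbol Γ) → Prop}
    {x₁ x₂ x₃ : Reg} (hx : ∀ x ∈ [x₁, x₂, x₃], x ≠ .z₁ ∧ x ≠ .z₂ ∧ x ≠ .z₃ ∧ x ≠ .ok)
    (hB : 1 ≤ B) (h₁ : (S x₁).length ≤ B) (h₂ : (S x₂).length ≤ B) (h₃ : (S x₃).length ≤ B)
    (hz₁ : S .z₁ = []) (hz₂ : S .z₂ = []) (hz₃ : S .z₃ = []) (ho : S .ok = []) :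
    (zipTest R x₁ x₂ x₃).Runs O B S
      (update S .ok (flagOf (ZipRel R (S x₁).reverse (S x₂).reverse (S x₃).reverse))) := by
  simp only [List.mem_cons, List.not_mem_nil, or_false, forall_eq_or_imp, forall_eq] at hx
  obtain ⟨⟨a₁, a₂, a₃, a₄⟩, ⟨b₁, b₂, b₃, b₄⟩, ⟨c₁, c₂, c₃, c₄⟩⟩ := hx
  let T : List (Symbol Γ) → Store Reg Γ := fun pre => update (update (update (update S
    .z₁ (S x₁).reverse) .z₂ ((S x₂).reverse.drop pre.length)) .z₃
    ((S x₃).reverse.drop pre.length)) .ok (flagOf (ZipRel R pre (S x₂).reverse (S x₃).reverse))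
  refine .cons (.push _ _) (.cons (.pour ?_) (.cons (.pour ?_) (.cons (.pour ?_)
    (.cons (.loop T ?_ ?_ ?_) (.cons (.clear ?_) (.cons (.clear ?_) (.cons (.clear ?_)
    (.nil ?_))))))))
  · simpa [a₄] using h₁
  · simpa [b₄, b₁] using h₂
  · simpa [c₄, c₁, c₂] using h₃
  · simpa [a₄, hz₁] using h₁
  · funext v
    cases v <;> simp [T, a₄, b₄, b₁, c₄, c₁, c₂, hz₁, hz₂, hz₃, ho, flagOf, ZipRel]
  · intro pre a suf e
    have hR : ZipRel R (pre ++ [a]) (S x₂).reverse (S x₃).reverse ↔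
        ZipRel R pre (S x₂).reverse (S x₃).reverse ∧
          R a (S x₂).reverse[pre.length]? (S x₃).reverse[pre.length]? := forall_getElem?_concat
    refine .cons (S₁ := update (T pre) .ok
      (flagOf (ZipRel R (pre ++ [a]) (S x₂).reverse (S x₃).reverse)))
      (.case (o := (S x₂).reverse[pre.length]?) (by simp [T])
        (.case (o := (S x₃).reverse[pre.length]?) (by simp [T]) ?_))
      (.cons (.pop _) (.cons (.pop _) (.nil ?_)))
    · split_ifs with h
      · refine .of_eq ?_
        simp [T, hR, h]
      · refine (Runs.clear ?_).congr ?_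
        · simp only [T, update_self, flagOf]
          split_ifs <;> simp [hB]
        · simp [T, hR, h, flagOf]
    · funext v
      cases v <;> simp [T]
  · simpa [T, a₄, hz₁] using h₁
  · simp [T]; omega
  · simp [T]; omega
  · funext v
    cases v <;> simp [T, a₄, hz₁, hz₂, hz₃]

theorem Runs.ifZip {R : Symbol Γ → Option (Symbol Γ) → Option (Symbol Γ) → Prop}
    {x₁ x₂ x₃ : Reg} (hx : ∀ x ∈ [x₁, x₂, x₃], x ≠ .z₁ ∧ x ≠ .z₂ ∧ x ≠ .z₃ ∧ x ≠ .ok)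
    (hB : 1 ≤ B) (h₁ : (S x₁).length ≤ B) (h₂ : (S x₂).length ≤ B) (h₃ : (S x₃).length ≤ B)
    (hz₁ : S .z₁ = []) (hz₂ : S .z₂ = []) (hz₃ : S .z₃ = []) (ho : S .ok = [])
    (hp : ZipRel R (S x₁).reverse (S x₂).reverse (S x₃).reverse → p.Runs O B S S')
    (hq : ¬ZipRel R (S x₁).reverse (S x₂).reverse (S x₃).reverse → q.Runs O B S S') :
    (ifZip R x₁ x₂ x₃ p q).Runs O B S S' := by
  refine .cons (.zipTest hx hB h₁ h₂ h₃ hz₁ hz₂ hz₃ ho) (.cons ?_ (.nil rfl))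
  by_cases h : ZipRel R (S x₁).reverse (S x₂).reverse (S x₃).reverse
  · refine .case (o := some .top) (by simp [flagOf, h]) (.cons (.pop _) (.cons ?_ (.nil rfl)))
    convert! hp h
    simp [flagOf, h, ← ho]
  · refine .case (o := none) (by simp [flagOf, h]) ?_
    convert! hq h
    simp [flagOf, h, ← ho]

theorem Runs.pushVec {v : List Bool} (hv : S .vecOut = (v.map Symbol.bit).reverse)
    (hB : v.length ≤ B) : (pushVec : Prog Reg Γ).Runs O B S
      (update (update S .vecOut []) .stack (encodeWord v ++ S .stack)) := by
  refine .cons (.push _ _) (.cons (.pour ?_) (.cons (.clear ?_) (.nil ?_)))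
  · simpa [hv] using hB
  · simpa [hv] using hB
  · funext v
    cases v <;> simp [hv, encodeWord]

end Prog
end TeamSemantics

namespace TeamSemantics

open Function

/-! ### The values of literals -/

namespace Prog

variable {Γ : Type} {O : Oracle (Symbol Γ)} {B : ℕ} {S S' : Store Reg Γ} {p q : Prog Reg Γ}

/-- All stacks are empty that are used inside of a computation step only. -/
structure Clean (S : Store Reg Γ) : Prop where
  flag : S .flag = []
  vecL : S .vecL = []
  vecR : S .vecR = []
  vecOut : S .vecOut = []
  itL : S .itL = []
  itR : S .itR = []
  mask : S .mask = []
  maskL : S .maskL = []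
  maskR : S .maskR = []
  row : S .row = []
  var : S .var = []
  z₁ : S .z₁ = []
  z₂ : S .z₂ = []
  z₃ : S .z₃ = []
  ok : S .ok = []
  hit : S .hit = []
  arg : S .arg = []
  tmp : S .tmp = []

theorem length_le_length_flatMap_encodeWord (words : List (List Bool)) :
    words.length ≤ (words.flatMap (encodeWord (Γ := Γ))).length := by
  induction words with
  | nil => simp
  | cons u l ih => simp [encodeWord] at ih ⊢; omega

theorem length_word_lt {words : List (List Bool)} {u : List Bool} (hu : u ∈ words) :
    u.length < (words.flatMap (encodeWord (Γ := Γ))).length := by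
  rw [List.length_flatMap]
  refine lt_of_lt_of_le ?_ (List.single_le_sum (by simp) _ (List.mem_map_of_mem hu))
  simp [encodeWord]

theorem flatMap_encodeWord_flatMap {words : List (List Bool)}
    {g : Symbol Γ → List (Symbol Γ)} :
    (words.flatMap encodeWord).flatMap g =
      words.flatMap fun u => u.flatMap (fun b => g (.bit b)) ++ g .endmark := by
  simp [List.flatMap_assoc, encodeWord, List.flatMap_map]

/-- A team satisfies a literal iff each of its rows does: `cs` lists the values of the rows. -/
theorem Runs.flatVec {M : List (List Bool)} {cs : List Bool} {F : List Bool → Bool} (hS : Clean S)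
    (hm : S .masks = M.flatMap encodeWord) (hc : S .col = (cs.map Symbol.bit).reverse)
    (hF : ∀ u ∈ M, F u = true ↔ ∀ i : ℕ, u[i]? = some true → cs[i]? = some true)
    (hB : 1 ≤ B) (hM : (S .masks).length ≤ B) (hcB : cs.length ≤ B) :
    (flatVec : Prog Reg Γ).Runs O B S
      (update (update S .col []) .stack (encodeWord (M.map F) ++ S .stack)) := by
  refine .cons (.forWords (fun pre => update S .vecOut ((pre.map F).map Symbol.bit).reverse)
    hm hM ?_ ?_ ?_) (.cons (.clear ?_) (.cons (.pushVec (v := M.map F) ?_ ?_) (.nil ?_)))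
  · simp [hS.vecOut]
  · simp [hS.mask]
  · intro pre u suf e
    have hu : u ∈ M := by simp [e]
    have huB : u.length < (S .masks).length := hm ▸ length_word_lt hu
    have hR : ZipRel (Γ := Γ) (fun a b _ => a = .bit true → b = some (.bit true))
        (u.map Symbol.bit) (cs.map Symbol.bit) (cs.map Symbol.bit) ↔ F u = true := by
      rw [hF u hu]
      simp only [ZipRel, List.getElem?_map, Option.map_eq_some_iff]
      constructor
      · intro h i hi
        obtain ⟨b, hb, e⟩ := h i _ ⟨true, hi, rfl⟩ rfl
        injection e with e
        exact e ▸ hb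
      · rintro h i c ⟨b, hb, rfl⟩ e
        injection e with e
        exact ⟨true, h i (e ▸ hb), rfl⟩
    refine .ifZip (by simp) hB ?_ ?_ ?_ ?_ ?_ ?_ ?_ ?_ ?_
    · simpa using by omega
    · simpa [hc] using hcB
    · simpa [hc] using hcB
    · simp [hS.z₁]
    · simp [hS.z₂]
    · simp [hS.z₃]
    · simp [hS.ok]
    · intro h
      simp only [update_self, ne_eq, reduceCtorEq, not_false_eq_true, update_of_ne, hc,
        List.reverse_reverse, hR] at h
      refine (push _ _).congr ?_
      funext v
      cases v <;> simp [h]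
    · intro h
      simp only [update_self, ne_eq, reduceCtorEq, not_false_eq_true, update_of_ne, hc,
        List.reverse_reverse, hR, Bool.not_eq_true] at h
      refine (push _ _).congr ?_
      funext v
      cases v <;> simp [h]
  · simpa [hc] using hcB
  · simp
  · have := length_le_length_flatMap_encodeWord (Γ := Γ) M
    rw [← hm] at this
    simpa using by omega
  · funext v
    cases v <;> simp [hS.vecOut]

theorem Runs.constCol {b : Bool} {R : List (List Bool)} (hr : S .rows = R.flatMap encodeWord)
    (hc : S .col = []) (hB : (S .rows).length ≤ B) : (constCol b : Prog Reg Γ).Runs O B S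
      (update S .col ((R.map fun _ => b).map Symbol.bit).reverse) := by
  refine (Runs.translate hB).congr ?_
  rw [hr, hc, flatMap_encodeWord_flatMap]
  have h : ∀ u : List Bool, u.flatMap (fun _ => ([] : List (Symbol Γ))) = [] := by simp
  simp only [h, List.nil_append, ← List.map_eq_flatMap]
  simp

theorem Runs.ifEq {x y : Reg} {u v : List Bool}
    (hx : x ≠ .z₁ ∧ x ≠ .z₂ ∧ x ≠ .z₃ ∧ x ≠ .ok) (hy : y ≠ .z₁ ∧ y ≠ .z₂ ∧ y ≠ .z₃ ∧ y ≠ .ok)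
    (hB : 1 ≤ B) (h₁ : S x = (u.map Symbol.bit).reverse) (h₂ : S y = (v.map Symbol.bit).reverse)
    (hxB : u.length ≤ B) (hyB : v.length ≤ B) (hz₁ : S .z₁ = []) (hz₂ : S .z₂ = [])
    (hz₃ : S .z₃ = []) (ho : S .ok = []) (hp : u = v → p.Runs O B S S') (hq : u ≠ v → S = S') :
    (ifEq x y p).Runs O B S S' := by
  have hinj : Injective (Symbol.bit (Γ := Γ)) := fun a b h => by injection h
  have key : ∀ {u v w : List Bool},
      ZipRel (fun a b _ => b = some a) (u.map (Symbol.bit (Γ := Γ))) (v.map Symbol.bit)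
        (w.map Symbol.bit) ↔ ∀ (i : ℕ) b, u[i]? = some b → v[i]? = some b := by
    intro u v w
    simp only [ZipRel, List.getElem?_map, Option.map_eq_some_iff, forall_exists_index, and_imp]
    constructor
    · intro h i b hb
      obtain ⟨b', h₁, h₂⟩ := h i _ b hb rfl
      rwa [hinj h₂] at h₁
    · rintro h i c b hb rfl
      exact ⟨b, h i b hb, rfl⟩
  have heq : u = v ↔ (∀ (i : ℕ) b, u[i]? = some b → v[i]? = some b) ∧
      (∀ (i : ℕ) b, v[i]? = some b → u[i]? = some b) := by
    constructor
    · rintro rfl; simp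
    · exact fun h => List.ext_getElem? fun i => Option.ext fun b => ⟨h.1 i b, h.2 i b⟩
  refine .ifZip (by simp [hx, hy]) hB ?_ ?_ ?_ hz₁ hz₂ hz₃ ho (fun k₁ => ?_) (fun k₁ => .of_eq ?_)
  · simpa [h₁] using hxB
  · simpa [h₂] using hyB
  · simpa [h₂] using hyB
  · refine .ifZip (by simp [hx, hy]) hB ?_ ?_ ?_ hz₁ hz₂ hz₃ ho (fun k₂ => ?_)
      (fun k₂ => .of_eq ?_)
    · simpa [h₂] using hyB
    · simpa [h₁] using hxB
    · simpa [h₁] using hxB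
    all_goals simp only [h₁, h₂, List.reverse_reverse, key] at k₁ k₂
    · exact hp (heq.mpr ⟨k₁, k₂⟩)
    · exact hq fun h => k₂ (heq.mp h).2
  · simp only [h₁, h₂, List.reverse_reverse, key] at k₁
    exact hq fun h => k₁ (heq.mp h).1

/-- The row `r` has the entry `1` in the column that is labelled by `x`. -/
def Hit (X : List (List Bool)) (r : List Bool) (x : List Bool) : Prop :=
  ∃ i : ℕ, X[i]? = some x ∧ r[i]? = some true

theorem hit_concat {X : List (List Bool)} {r x y : List Bool} :
    Hit (X ++ [y]) r x ↔ Hit X r x ∨ y = x ∧ r[X.length]? = some true := by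
  constructor
  · rintro ⟨i, h₁, h₂⟩
    rcases lt_trichotomy i X.length with hi | rfl | hi
    · exact .inl ⟨i, by rwa [List.getElem?_append_left hi] at h₁, h₂⟩
    · exact .inr ⟨by simpa using h₁, h₂⟩
    · rw [List.getElem?_eq_none (by simp; omega)] at h₁
      cases h₁
  · rintro (⟨i, h₁, h₂⟩ | ⟨rfl, h⟩)
    · exact ⟨i, by rwa [List.getElem?_append_left (List.getElem?_eq_some_iff.mp h₁).1], h₂⟩
    · exact ⟨X.length, by simp, h⟩

theorem Runs.caseFlag {x : Reg} {P : Prop} {k : Option (Symbol Γ) → Prog Reg Γ}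
    (h : S x = flagOf P) (hp : P → (k (some .top)).Runs O B S S')
    (hn : ¬P → (k none).Runs O B S S') : (Prog.case x k).Runs O B S S' := by
  by_cases hP : P
  · exact .case (by simp [h, flagOf, hP]) (hp hP)
  · exact .case (by simp [h, flagOf, hP]) (hn hP)

theorem length_flagOf_le {P : Prop} (hB : 1 ≤ B) : (flagOf (Γ := Γ) P).length ≤ B := by
  rw [flagOf]
  split_ifs <;> simp [hB]

theorem setHit_runs {P : Prop} (hB : 1 ≤ B) (h : S .hit = flagOf P) :
    (block [clear .hit, push .hit .top] : Prog Reg Γ).Runs O B S (update S .hit [.top]) := by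
  refine .cons (.clear ?_) (.cons (.push _ _) (.nil (by simp)))
  exact h ▸ length_flagOf_le hB

/-- A variable without a column has the value `0`, in accordance with `Hit`. -/
theorem Runs.litCol {b : Bool} {R X : List (List Bool)} {x : List Bool} {F : List Bool → Bool}
    (hS : Clean S) (hr : S .rows = R.flatMap encodeWord) (hX : S .vars = X.flatMap encodeWord)
    (hx : S .name = (x.map Symbol.bit).reverse) (hc : S .col = [])
    (hF : ∀ r ∈ R, F r = b ↔ Hit X r x)
    (hB : 1 ≤ B) (hR : (S .rows).length ≤ B) (hXB : (S .vars).length ≤ B) (hxB : x.length ≤ B) :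
    (litCol b : Prog Reg Γ).Runs O B S (update S .col ((R.map F).map Symbol.bit).reverse) := by
  refine .forWords (fun pre => update S .col ((pre.map F).map Symbol.bit).reverse)
    hr hR ?_ ?_ ?_
  · rw [List.map_nil, List.map_nil, List.reverse_nil, ← hc, update_eq_self]
  · simp [hS.row]
  · intro pre r suf e
    have hr' : r ∈ R := by simp [e]
    have hrB : r.length < (S .rows).length := hr ▸ length_word_lt hr'
    set S₁ := update (update S .col ((pre.map F).map Symbol.bit).reverse) .row
      (r.map Symbol.bit).reverse with hS₁
    refine .cons (.pour ?_) (.cons (.forWords (fun pre => update (update S₁ .tmp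
      ((r.map Symbol.bit).drop pre.length)) .hit (flagOf (Hit pre r x)))
      (words := X) ?_ ?_ ?_ ?_ ?_) (.cons (.clear ?_) (.cons
      (S₁ := update (update S₁ .hit (flagOf (Hit X r x))) .col (.bit (F r) :: S₁ .col))
      (.caseFlag (P := Hit X r x) ?_ (fun h => ?_) (fun h => ?_))
      (.cons (.clear ?_) (.nil ?_)))))
    · simpa [hS₁] using by omega
    · simpa [hS₁] using hX
    · simpa [hS₁] using hXB
    · funext v
      cases v <;> simp [hS₁, hS.tmp, hS.hit, Hit, flagOf]
    · simp [hS₁, hS.var]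
    · intro preX y sufX eX
      have hyB : y.length < (S .vars).length := hX ▸ length_word_lt (by simp [eX])
      refine .cons (S₁ := update (update (update S₁ .tmp ((r.map Symbol.bit).drop preX.length))
        .hit (flagOf (Hit (preX ++ [y]) r x))) .var (y.map Symbol.bit).reverse)
        (.ifTrue (fun h => ?_) fun h => .of_eq ?_) (.cons (.pop _) (.nil ?_))
      · have h' : r[preX.length]? = some true := by
          simpa [Option.map_eq_some_iff] using h
        refine .ifEq (u := y) (v := x) (by simp) (by simp) hB ?_ ?_ (by omega) hxB ?_ ?_ ?_ ?_
          (fun e => ?_) (fun e => ?_)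
        · simp
        · simp [hS₁, hx]
        · simp [hS₁, hS.z₁]
        · simp [hS₁, hS.z₂]
        · simp [hS₁, hS.z₃]
        · simp [hS₁, hS.ok]
        · refine (setHit_runs (P := Hit preX r x) hB (by simp)).congr ?_
          have : Hit (preX ++ [y]) r x := hit_concat.mpr (.inr ⟨e, h'⟩)
          funext v
          cases v <;> simp [this, flagOf]
        · have : Hit (preX ++ [y]) r x ↔ Hit preX r x := by simp [hit_concat, e]
          simp [this]
      · have h' : r[preX.length]? ≠ some true := by
          simpa [Option.map_eq_some_iff] using h
        have : Hit (preX ++ [y]) r x ↔ Hit preX r x := by simp [hit_concat, h']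
        simp [this]
      · funext v
        cases v <;> simp
    · simpa using by omega
    · simp
    · refine (push _ _).congr ?_
      rw [← (hF r hr').mpr h]
      funext v
      cases v <;> simp [hS₁, hS.tmp]
    · have h' : (!b) = F r := by
        have := mt (hF r hr').mp h
        revert this
        cases b <;> cases F r <;> simp
      refine (push _ _).congr ?_
      rw [h']
      funext v
      cases v <;> simp [hS₁, hS.tmp]
    · simpa using length_flagOf_le hB
    · funext v
      cases v <;> simp [hS₁, hS.hit]

end Prog
end TeamSemantics

namespace TeamSemantics

open Function

/-! ### The values of atoms -/

/-- The entries of `l` that are selected by the mask `u`. -/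
def select {α : Type} : List α → List Bool → List α
  | a :: l, b :: u => if b then a :: select l u else select l u
  | _, _ => []

theorem select_concat {α : Type} (l : List α) (a : α) (u : List Bool) :
    select (l ++ [a]) u = select l u ++ if u[l.length]? = some true then [a] else [] := by
  induction l generalizing u with
  | nil => rcases u with _ | ⟨b, u⟩ <;> simp [select]
  | cons c l ih =>
    rcases u with _ | ⟨b, u⟩
    · simp [select]
    · cases b <;> simp [select, ih]

theorem select_sublist {α : Type} (l : List α) (u : List Bool) : (select l u).Sublist l := by
  induction l generalizing u with
  | nil => simp [select]
  | cons a l ih =>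
    rcases u with _ | ⟨b, u⟩
    · simp [select]
    · cases b <;> simp [select, ih, List.Sublist.cons]

theorem mem_select {α : Type} {l : List α} {u : List Bool} {a : α} :
    a ∈ select l u ↔ ∃ i : ℕ, l[i]? = some a ∧ u[i]? = some true := by
  induction l generalizing u with
  | nil => simp [select]
  | cons c l ih =>
    rcases u with _ | ⟨b, u⟩
    · simp [select]
    · constructor
      · intro h
        cases b
        · obtain ⟨i, hi⟩ := ih.mp (by simpa [select] using h)
          exact ⟨i + 1, by simpa using hi⟩
        · rcases List.mem_cons.mp (by simpa [select] using h) with rfl | h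
          · exact ⟨0, by simp⟩
          · obtain ⟨i, hi⟩ := ih.mp h
            exact ⟨i + 1, by simpa using hi⟩
      · rintro ⟨i, h₁, h₂⟩
        cases i with
        | zero => simp_all [select]
        | succ i =>
          have := ih.mpr ⟨i, by simpa using h₁, by simpa using h₂⟩
          cases b <;> simp [select, this]

namespace Prog

variable {Γ : Type} {O : Oracle (Symbol Γ)} {B : ℕ} {S S' : Store Reg Γ} {p q : Prog Reg Γ}

theorem Runs.call {x y : Reg} {b : Bool} (hB : (S x).length ≤ B) (h : O.ans (S x).reverse b) :
    (call x y : Prog Reg Γ).Runs O B S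
      (update (update S x []) y (Symbol.bit b :: update S x [] y)) :=
  fun _ hQ => ⟨hB, b, h, hQ⟩

theorem length_flatMap_select_le (R : List (List Bool)) (u : List Bool) :
    ((select R u).flatMap (encodeWord (Γ := Γ))).length ≤
      (R.flatMap (encodeWord (Γ := Γ))).length :=
  ((select_sublist R u).flatMap _).length_le

/-- The question is the encoding of the table with the selected rows and of the atom; it is written
to `arg` in reversed form, because questions are read from the bottom. -/
theorem Runs.writeArg {R : List (List Bool)} {u : List Bool} (h₁ : S .tmp = []) (h₂ : S .arg = [])
    (h₃ : S .row = []) (h₄ : S .z₁ = [])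
    (hr : S .rows = R.flatMap encodeWord) (hu : S .mask = (u.map Symbol.bit).reverse)
    (huB : u.length ≤ B) (hR : (S .rows).length ≤ B) (hX : (S .vars).length ≤ B)
    (hn : (S .name).length ≤ B) :
    (writeArg : Prog Reg Γ).Runs O B S (update S .arg
      (S .vars ++ [Symbol.bar] ++ (select R u).flatMap encodeWord ++ [Symbol.bar] ++
        (Symbol.atom :: ((S .name).reverse ++ [Symbol.endmark]))).reverse) := by
  refine .cons (.pour ?_) (.cons (.pour ?_) (.cons (.push _ _) (.cons (.forWords (words := R)
    (fun pre => update (update S .tmp ((u.map Symbol.bit).drop pre.length)) .arg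
      (S .vars ++ [Symbol.bar] ++ (select pre u).flatMap encodeWord).reverse) ?_ ?_ ?_ ?_
      fun pre r suf e => ?_) (.cons (.clear ?_) (.cons (.push _ _) (.cons (.push _ _)
      (.cons (.pour ?_) (.cons (.pour ?_) (.cons (.clear ?_) (.cons (.push _ _)
      (.nil ?_)))))))))))
  · simpa [hu] using huB
  · simpa using hX
  · simpa using hr
  · simpa using hR
  · funext v
    cases v <;> simp [h₁, h₂, hu, select]
  · simp [h₃]
  · have hrB : r.length < (S .rows).length := hr ▸ length_word_lt (by simp [e])
    refine .cons (S₁ := update (update (update S .tmp ((u.map Symbol.bit).drop pre.length)) .arg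
      (S .vars ++ [Symbol.bar] ++ (select (pre ++ [r]) u).flatMap encodeWord).reverse) .row
      (r.map Symbol.bit).reverse) (.ifTrue (fun h => ?_) (fun h => .of_eq ?_))
      (.cons (.pop _) (.nil ?_))
    · have h' : u[pre.length]? = some true := by simpa [Option.map_eq_some_iff] using h
      refine .cons (.pour ?_) (.cons (.pour ?_) (.cons (.clear ?_) (.cons (.push _ _) (.nil ?_))))
      · simpa using by omega
      · simpa [h₄] using by omega
      · simpa [h₄] using by omega
      · funext v
        cases v <;> simp [h₄, select_concat, h', encodeWord]
    · have h' : u[pre.length]? ≠ some true := by simpa [Option.map_eq_some_iff] using h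
      funext v
      cases v <;> simp [select_concat, h']
    · funext v
      cases v <;> simp
  · simp; omega
  · simpa using hn
  · simpa [h₄] using hn
  · simpa [h₄] using hn
  · funext v
    cases v <;> simp [h₄, h₁]

/-- The oracle is asked once for each mask. -/
theorem Runs.atomVec {M R : List (List Bool)} {F : List Bool → Bool} (hS : Clean S)
    (hm : S .masks = M.flatMap encodeWord) (hr : S .rows = R.flatMap encodeWord)
    (hF : ∀ u ∈ M, O.ans (S .vars ++ [Symbol.bar] ++ (select R u).flatMap encodeWord ++
        [Symbol.bar] ++ (Symbol.atom :: ((S .name).reverse ++ [Symbol.endmark]))) (F u))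
    (hM : (S .masks).length ≤ B)
    (hB : (S .vars).length + (S .rows).length + (S .name).length + 4 ≤ B) :
    (atomVec : Prog Reg Γ).Runs O B S
      (update S .stack (encodeWord (M.map F) ++ S .stack)) := by
  refine .cons (.forWords (fun pre => update S .vecOut ((pre.map F).map Symbol.bit).reverse)
    hm hM ?_ ?_ ?_) (.cons (.pushVec (v := M.map F) ?_ ?_) (.nil ?_))
  · simp [hS.vecOut]
  · simp [hS.mask]
  · intro pre u suf e
    have hu : u ∈ M := by simp [e]
    have huB : u.length < (S .masks).length := hm ▸ length_word_lt hu
    have hlen := length_flatMap_select_le (Γ := Γ) R u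
    rw [← hr] at hlen
    refine .cons (.writeArg (R := R) (u := u) ?_ ?_ ?_ ?_ ?_ ?_ ?_ ?_
      ?_ ?_) (.cons (.call (b := F u) ?_ ?_)
      (.nil ?_))
    · simp [hS.tmp]
    · simp [hS.arg]
    · simp [hS.row]
    · simp [hS.z₁]
    · simp [hr]
    · simp
    · omega
    · simp; omega
    · simp; omega
    · simp; omega
    · simp at hlen ⊢; omega
    · simpa using hF u hu
    · funext v
      cases v <;> simp [hS.arg]
  · simp
  · have := length_le_length_flatMap_encodeWord (Γ := Γ) M
    rw [← hm] at this
    simpa using by omega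
  · funext v
    cases v <;> simp [hS.vecOut]

end Prog
end TeamSemantics

namespace TeamSemantics

open Function

/-! ### The values of conjunctions and disjunctions -/

namespace Prog

variable {Γ : Type} {O : Oracle (Symbol Γ)} {B : ℕ} {S S' : Store Reg Γ} {p q : Prog Reg Γ}

theorem Runs.popVecs {v w : List Bool} {rest : List (Symbol Γ)} (hS : Clean S)
    (hs : S .stack = encodeWord v ++ (encodeWord w ++ rest)) (hB : (S .stack).length ≤ B) :
    (popVecs : Prog Reg Γ).Runs O B S (update (update (update S .stack rest)
      .vecR (v.map Symbol.bit).reverse) .vecL (w.map Symbol.bit).reverse) := by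
  refine .cons (.popUntil (u := v.map Symbol.bit) (rest := encodeWord w ++ rest) (by simp)
    (by simp) (by simp) ?_ (by simp) ?_ ?_ hB) (.cons (.popUntil (u := w.map Symbol.bit)
    (rest := rest) (by simp) (by simp) (by simp) ?_ (by simp) ?_ ?_ ?_) (.nil ?_))
  · simp [hs, encodeWord]
  · exact hS.vecR
  · exact hS.flag
  · simp [encodeWord]
  · simp [hS.vecL]
  · simp [hS.flag]
  · simp [hs] at hB ⊢; omega
  · funext v
    cases v <;> simp

theorem Runs.andVec {M : List (List Bool)} {F G : List Bool → Bool} {rest : List (Symbol Γ)}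
    (hS : Clean S) (hs : S .stack = encodeWord (M.map G) ++ (encodeWord (M.map F) ++ rest))
    (hB : (S .stack).length ≤ B) :
    (andVec : Prog Reg Γ).Runs O B S
      (update S .stack (encodeWord (M.map fun u => F u && G u) ++ rest)) := by
  have hM : M.length ≤ B := by
    simp [hs, encodeWord] at hB; omega
  set S₁ := update (update (update S .stack rest)
      .vecR ((M.map G).map Symbol.bit).reverse) .vecL ((M.map F).map Symbol.bit).reverse with hS₁
  refine .cons (.popVecs hS hs hB) (.cons (.pour ?_) (.cons (.pour ?_) (.cons (.loop (fun pre =>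
    update (update (update S₁ .itR ((M.map G).map Symbol.bit)) .itL
      (((M.map F).map Symbol.bit).drop pre.length)) .vecOut
      (((M.map fun u => F u && G u).take pre.length).map Symbol.bit).reverse) ?_ ?_
      fun pre a suf e => ?_) (.cons (.clear ?_) (.cons (.clear ?_) (.cons (.clear ?_)
      (.cons (.clear ?_) (.cons (.pushVec (v := M.map fun u => F u && G u) ?_ ?_)
      (.nil ?_)))))))))
  · simpa [hS₁] using hM
  · simpa [hS₁] using hM
  · simpa [hS₁, hS.itR] using hM
  · funext v
    cases v <;> simp [hS₁, hS.itR, hS.itL, hS.vecOut]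
  · have e : (M.map G).map Symbol.bit = pre ++ a :: suf := by simpa [hS₁, hS.itR] using e
    have h₁ : ((M.map G).map (Symbol.bit (Γ := Γ)))[pre.length]? = some a := by simp [e]
    simp only [List.map_map, List.getElem?_map, Option.map_eq_some_iff, comp_apply] at h₁
    obtain ⟨u, hu, rfl⟩ := h₁
    refine .cons (S₁ := update (update (update S₁ .itR ((M.map G).map Symbol.bit)) .itL
      (((M.map F).map Symbol.bit).drop pre.length)) .vecOut
      (((M.map fun u => F u && G u).take (pre.length + 1)).map Symbol.bit).reverse) ?_
      (.cons (.pop _) (.nil ?_))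
    · cases hG : G u
      · refine (Runs.push _ _).congr ?_
        simp [hS₁, List.take_add_one, hu, hG]
      · refine .ifTrue (fun h => ?_) (fun h => ?_)
        · have hF : F u = true := by simpa [hu] using h
          refine (Runs.push _ _).congr ?_
          simp [hS₁, List.take_add_one, hu, hG, hF]
        · have hF : F u = false := by simpa [hu] using h
          refine (Runs.push _ _).congr ?_
          simp [hS₁, List.take_add_one, hu, hG, hF]
    · funext v
      cases v <;> simp
  · simp
  · simpa using hM
  · simpa [hS₁] using hM
  · simpa [hS₁] using hM
  · simp [hS₁, hS.itR]
  · simpa using hM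
  · funext v
    cases v <;> simp [hS₁, hS.itR, hS.itL, hS.vecL, hS.vecR, hS.vecOut]

/-- In the semantics `m`, the set of rows with the mask `u` may be split into those with the masks
`v` and `w`. -/
def MaskSplit (Γ : Type) (m : Semantics) (u v w : List Bool) : Prop :=
  ZipRel (splitRel m) (u.map (Symbol.bit (Γ := Γ))) (v.map Symbol.bit) (w.map Symbol.bit)

theorem head?_drop_map_bit {M : List (List Bool)} {F : List Bool → Bool}
    {pre suf : List (List Bool)} {u : List Bool} (e : M = pre ++ u :: suf) :
    (((M.map F).map (Symbol.bit (Γ := Γ))).drop pre.length).head? = some (.bit (F u)) := by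
  simp [e]

variable {m : Semantics} {M : List (List Bool)} {F G : List Bool → Bool} {u v : List Bool}

/-- The flag may have been set by an earlier search, which is expressed by `P`. -/
theorem Runs.searchR {P : Prop} (hm : S .masks = M.flatMap encodeWord)
    (hu : S .mask = (u.map Symbol.bit).reverse) (hv : S .maskL = (v.map Symbol.bit).reverse)
    (hR : S .vecR = ((M.map G).map Symbol.bit).reverse) (hh : S .hit = flagOf P)
    (h₁ : S .z₁ = []) (h₂ : S .z₂ = []) (h₃ : S .z₃ = []) (h₄ : S .ok = []) (h₅ : S .itR = [])
    (h₆ : S .maskR = []) (hB : 1 ≤ B) (hM : (S .masks).length ≤ B) (huB : u.length ≤ B)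
    (hvB : v.length ≤ B) :
    (searchR m : Prog Reg Γ).Runs O B S
      (update S .hit (flagOf (P ∨ ∃ w ∈ M, G w = true ∧ MaskSplit Γ m u v w))) := by
  have hMB : M.length ≤ B := by
    have := length_le_length_flatMap_encodeWord (Γ := Γ) M
    rw [← hm] at this
    omega
  refine .cons (.pour ?_) (.cons (.forWords (words := M) (fun pre => update (update S .itR
    (((M.map G).map Symbol.bit).drop pre.length)) .hit
    (flagOf (P ∨ ∃ w ∈ pre, G w = true ∧ MaskSplit Γ m u v w))) ?_ ?_ ?_ ?_
    fun pre w suf e => ?_) (.cons (.clear ?_) (.nil ?_)))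
  · simpa [hR] using hMB
  · simpa using hm
  · simpa using hM
  · funext v
    cases v <;> simp [hR, h₅, hh]
  · simp [h₆]
  · have hwB : w.length < (S .masks).length := hm ▸ length_word_lt (by simp [e])
    have hhead := head?_drop_map_bit (Γ := Γ) (F := G) e
    refine .cons (S₁ := update (update (update S .itR
      (((M.map G).map Symbol.bit).drop pre.length)) .hit
      (flagOf (P ∨ ∃ z ∈ pre ++ [w], G z = true ∧ MaskSplit Γ m u v z))) .maskR
      (w.map Symbol.bit).reverse) (.ifTrue (fun h => ?_) (fun h => .of_eq ?_))
      (.cons (.pop _) (.nil ?_))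
    · have hG : G w = true := by
        simp only [update_self, ne_eq, reduceCtorEq, not_false_eq_true, update_of_ne, hhead] at h
        simpa using h
      refine .ifZip (by simp) hB ?_ ?_ ?_ ?_ ?_ ?_ ?_ (fun h => ?_) (fun h => .of_eq ?_)
      · simpa [hu] using huB
      · simpa [hv] using hvB
      · simpa using by omega
      · simp [h₁]
      · simp [h₂]
      · simp [h₃]
      · simp [h₄]
      · have h' : MaskSplit Γ m u v w := by simpa [MaskSplit, hu, hv] using h
        refine (setHit_runs (P := P ∨ ∃ w ∈ pre, G w = true ∧ MaskSplit Γ m u v w) hB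
          (by simp)).congr ?_
        funext v
        cases v <;> simp [flagOf, hG, h']
      · have h' : ¬MaskSplit Γ m u v w := by simpa [MaskSplit, hu, hv] using h
        simp [h', or_and_right, exists_or]
    · have hG : G w = false := by
        simp only [update_self, ne_eq, reduceCtorEq, not_false_eq_true, update_of_ne, hhead] at h
        simpa using h
      simp [hG, or_and_right, exists_or]
    · funext v
      cases v <;> simp
  · simp
  · funext v
    cases v <;> simp [h₅]

theorem Runs.searchL (hm : S .masks = M.flatMap encodeWord)
    (hu : S .mask = (u.map Symbol.bit).reverse)
    (hL : S .vecL = ((M.map F).map Symbol.bit).reverse)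
    (hR : S .vecR = ((M.map G).map Symbol.bit).reverse) (hh : S .hit = [])
    (h₁ : S .z₁ = []) (h₂ : S .z₂ = []) (h₃ : S .z₃ = []) (h₄ : S .ok = []) (h₅ : S .itR = [])
    (h₆ : S .maskR = []) (h₇ : S .itL = []) (h₈ : S .maskL = [])
    (hB : 1 ≤ B) (hM : (S .masks).length ≤ B) (huB : u.length ≤ B) :
    (searchL m : Prog Reg Γ).Runs O B S (update S .hit
      (flagOf (∃ v ∈ M, F v = true ∧ ∃ w ∈ M, G w = true ∧ MaskSplit Γ m u v w))) := by
  have hMB : M.length ≤ B := by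
    have := length_le_length_flatMap_encodeWord (Γ := Γ) M
    rw [← hm] at this
    omega
  refine .cons (.pour ?_) (.cons (.forWords (words := M) (fun pre => update (update S .itL
    (((M.map F).map Symbol.bit).drop pre.length)) .hit
    (flagOf (∃ v ∈ pre, F v = true ∧ ∃ w ∈ M, G w = true ∧ MaskSplit Γ m u v w))) ?_ ?_ ?_ ?_
    fun pre v suf e => ?_) (.cons (.clear ?_) (.nil ?_)))
  · simpa [hL] using hMB
  · simpa using hm
  · simpa using hM
  · funext v
    cases v <;> simp [hL, h₇, hh, flagOf]
  · simp [h₈]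
  · have hvB : v.length < (S .masks).length := hm ▸ length_word_lt (by simp [e])
    have hhead := head?_drop_map_bit (Γ := Γ) (F := F) e
    refine .cons (S₁ := update (update (update S .itL
      (((M.map F).map Symbol.bit).drop pre.length)) .hit
      (flagOf (∃ z ∈ pre ++ [v], F z = true ∧ ∃ w ∈ M, G w = true ∧ MaskSplit Γ m u z w))) .maskL
      (v.map Symbol.bit).reverse) (.ifTrue (fun h => ?_) (fun h => .of_eq ?_))
      (.cons (.pop _) (.nil ?_))
    · have hF : F v = true := by
        simp only [update_self, ne_eq, reduceCtorEq, not_false_eq_true, update_of_ne, hhead] at h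
        simpa using h
      refine (Runs.searchR (M := M) (G := G) (u := u) (v := v)
        (P := ∃ v ∈ pre, F v = true ∧ ∃ w ∈ M, G w = true ∧ MaskSplit Γ m u v w)
        ?_ ?_ ?_ ?_ ?_ ?_ ?_ ?_ ?_ ?_ ?_ hB ?_ huB (by omega)).congr ?_
      · simpa using hm
      · simpa using hu
      · simp
      · simpa using hR
      · simp
      · simp [h₁]
      · simp [h₂]
      · simp [h₃]
      · simp [h₄]
      · simp [h₅]
      · simp [h₆]
      · simpa using hM
      · funext v
        cases v <;> simp [hF, or_and_right, exists_or]
    · have hF : F v = false := by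
        simp only [update_self, ne_eq, reduceCtorEq, not_false_eq_true, update_of_ne, hhead] at h
        simpa using h
      simp [hF, or_and_right, exists_or]
    · funext v
      cases v <;> simp
  · simp
  · funext v
    cases v <;> simp [h₇]

/-- Each mask is tested against all pairs of masks. -/
theorem Runs.orVec {H : List Bool → Bool} {rest : List (Symbol Γ)} (hS : Clean S)
    (hm : S .masks = M.flatMap encodeWord)
    (hs : S .stack = encodeWord (M.map G) ++ (encodeWord (M.map F) ++ rest))
    (hH : ∀ u ∈ M, H u = true ↔
      ∃ v ∈ M, F v = true ∧ ∃ w ∈ M, G w = true ∧ MaskSplit Γ m u v w)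
    (hB : (S .stack).length ≤ B) (hM : (S .masks).length ≤ B) :
    (orVec m : Prog Reg Γ).Runs O B S (update S .stack (encodeWord (M.map H) ++ rest)) := by
  have hB₁ : 1 ≤ B := by
    simp [hs, encodeWord] at hB; omega
  have hMB : M.length ≤ B := by
    simp [hs, encodeWord] at hB; omega
  set S₁ := update (update (update S .stack rest)
      .vecR ((M.map G).map Symbol.bit).reverse) .vecL ((M.map F).map Symbol.bit).reverse with hS₁
  refine .cons (.popVecs hS hs hB) (.cons (.forWords (words := M)
    (fun pre => update S₁ .vecOut ((pre.map H).map Symbol.bit).reverse) ?_ ?_ ?_ ?_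
    fun pre u suf e => ?_) (.cons (.clear ?_) (.cons (.clear ?_)
      (.cons (.pushVec (v := M.map H) ?_ ?_) (.nil ?_)))))
  · simpa [hS₁] using hm
  · simpa [hS₁] using hM
  · funext v
    cases v <;> simp [hS₁, hS.vecOut]
  · simp [hS₁, hS.mask]
  · have hu : u ∈ M := by simp [e]
    have huB : u.length < (S .masks).length := hm ▸ length_word_lt hu
    set P := ∃ v ∈ M, F v = true ∧ ∃ w ∈ M, G w = true ∧ MaskSplit Γ m u v w with hP
    refine .cons (.searchL (M := M) (F := F) (G := G) (u := u) ?_ ?_ ?_ ?_ ?_ ?_ ?_ ?_ ?_ ?_ ?_ ?_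
      ?_ hB₁ ?_ (by omega)) (.cons (S₁ := update (update (update S₁ .vecOut
        (((pre ++ [u]).map H).map Symbol.bit).reverse) .mask (u.map Symbol.bit).reverse) .hit
        (flagOf P)) (.caseFlag (P := P) ?_ (fun h => ?_) (fun h => ?_)) (.cons (.clear ?_)
        (.nil ?_)))
    · simpa [hS₁] using hm
    · simp
    · simp [hS₁]
    · simp [hS₁]
    · simp [hS₁, hS.hit]
    · simp [hS₁, hS.z₁]
    · simp [hS₁, hS.z₂]
    · simp [hS₁, hS.z₃]
    · simp [hS₁, hS.ok]
    · simp [hS₁, hS.itR]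
    · simp [hS₁, hS.maskR]
    · simp [hS₁, hS.itL]
    · simp [hS₁, hS.maskL]
    · simpa [hS₁] using hM
    · simp [hP]
    · have h' : H u = true := (hH u hu).mpr h
      refine (Runs.push _ _).congr ?_
      funext v
      cases v <;> simp [h', hP]
    · have h' : H u = false := by simpa using mt (hH u hu).mp h
      refine (Runs.push _ _).congr ?_
      funext v
      cases v <;> simp [h', hP]
    · simpa using length_flagOf_le hB₁
    · funext v
      cases v <;> simp [hS₁, hS.hit]
  · simpa [hS₁] using hMB
  · simpa [hS₁] using hMB
  · simp
  · simpa using hMB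
  · funext v
    cases v <;> simp [hS₁, hS.vecL, hS.vecR, hS.vecOut]

end Prog
end TeamSemantics

namespace TeamSemantics

open Function

/-! ### Teams as bit masks -/

/-- All masks of length `k`, the one without zeros first. -/
def allMasks : ℕ → List (List Bool)
  | 0 => [[]]
  | k + 1 => (allMasks k).map (· ++ [true]) ++ (allMasks k).map (· ++ [false])

theorem mem_allMasks {k : ℕ} {u : List Bool} : u ∈ allMasks k ↔ u.length = k := by
  induction k generalizing u with
  | zero => simp [allMasks]
  | succ k ih =>
    simp only [allMasks, List.mem_append, List.mem_map, ih]
    constructor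
    · rintro (⟨v, rfl, rfl⟩ | ⟨v, rfl, rfl⟩) <;> simp
    · intro h
      rcases List.eq_nil_or_concat u with rfl | ⟨v, b, rfl⟩
      · simp at h
      · have hv : v.length = k := by simpa using h
        cases b
        · exact .inr ⟨v, hv, by simp⟩
        · exact .inl ⟨v, hv, by simp⟩

theorem length_allMasks (k : ℕ) : (allMasks k).length = 2 ^ k := by
  induction k with
  | zero => rfl
  | succ k ih => simp [allMasks, ih, pow_succ]; omega

theorem head?_allMasks (k : ℕ) : (allMasks k).head? = some (List.replicate k true) := by
  induction k with
  | zero => rfl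
  | succ k ih => simp [allMasks, ih, List.replicate_succ']

theorem rowAssignment_getElem {vars : List Var} (hv : vars.Nodup) {r : List Bool} {i : ℕ}
    (hi : i < vars.length) : rowAssignment vars r vars[i] = r.getD i false := by
  rw [rowAssignment, hv.idxOf_getElem]

theorem rowAssignment_eq_true_iff {vars : List Var} (hv : vars.Nodup) {r : List Bool}
    (hr : r.length = vars.length) {x : Var} :
    rowAssignment vars r x = true ↔ Prog.Hit vars r x := by
  constructor
  · intro h
    rw [rowAssignment, List.getD_eq_getElem?_getD] at h
    have h' : r[vars.idxOf x]? = some true := by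
      cases e : r[vars.idxOf x]? with
      | none => simp [e] at h
      | some b => simpa [e] using h
    have hx := hr ▸ (List.getElem?_eq_some_iff.mp h').1
    exact ⟨_, by rw [List.getElem?_eq_getElem hx, List.getElem_idxOf], h'⟩
  · rintro ⟨i, h₁, h₂⟩
    obtain ⟨hi, rfl⟩ := List.getElem?_eq_some_iff.mp h₁
    rw [rowAssignment_getElem hv, List.getD_eq_getElem?_getD, h₂]
    rfl

theorem rowAssignment_injOn {vars : List Var} (hv : vars.Nodup) {r s : List Bool}
    (hr : r.length = vars.length) (hs : s.length = vars.length)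
    (h : rowAssignment vars r = rowAssignment vars s) : r = s := by
  refine List.ext_getElem (by omega) fun i h₁ h₂ => ?_
  have := congrFun h vars[i]
  rwa [rowAssignment_getElem hv, rowAssignment_getElem hv, List.getD_eq_getElem _ _ h₁,
    List.getD_eq_getElem _ _ h₂] at this

namespace TeamTable

variable (T : TeamTable)

/-- The table that consists of the rows that are selected by a mask. -/
def sub (u : List Bool) : TeamTable where
  vars := T.vars
  rows := select T.rows u
  vars_nodup := T.vars_nodup
  rows_nodup := T.rows_nodup.sublist (select_sublist _ _)
  length_row r hr := T.length_row r ((select_sublist _ _).subset hr)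

variable {T}

theorem mem_team_sub {u : List Bool} {s : Assignment} : s ∈ (T.sub u).team ↔
    ∃ (i : ℕ) (r : List Bool), T.rows[i]? = some r ∧ u[i]? = some true ∧
      s = rowAssignment T.vars r := by
  simp only [team, sub, Set.mem_ofPred_eq, mem_select]
  constructor
  · rintro ⟨r, ⟨i, h₁, h₂⟩, rfl⟩; exact ⟨i, r, h₁, h₂, rfl⟩
  · rintro ⟨i, r, h₁, h₂, rfl⟩; exact ⟨r, ⟨i, h₁, h₂⟩, rfl⟩

/-- Rows are determined by their assignments and occur only once, so that the mask can be recovered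
from the team. -/
theorem rowAssignment_mem_team_sub {u : List Bool} {i : ℕ} {r : List Bool}
    (hi : T.rows[i]? = some r) :
    rowAssignment T.vars r ∈ (T.sub u).team ↔ u[i]? = some true := by
  rw [mem_team_sub]
  constructor
  · rintro ⟨j, s, h₁, h₂, h₃⟩
    have : r = s := rowAssignment_injOn T.vars_nodup (T.length_row r (List.mem_of_getElem? hi))
      (T.length_row s (List.mem_of_getElem? h₁)) h₃
    subst this
    obtain ⟨hi', e₁⟩ := List.getElem?_eq_some_iff.mp hi
    obtain ⟨hj', e₂⟩ := List.getElem?_eq_some_iff.mp h₁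
    obtain rfl : i = j := (T.rows_nodup.getElem_inj_iff).mp (e₁.trans e₂.symm)
    exact h₂
  · exact fun h => ⟨i, r, hi, h, rfl⟩

theorem forall_mem_team_sub {u : List Bool} (hu : u.length = T.rows.length)
    {P : Assignment → Bool} : (∀ s ∈ (T.sub u).team, P s = true) ↔ ∀ i : ℕ, u[i]? = some true →
      (T.rows.map fun r => P (rowAssignment T.vars r))[i]? = some true := by
  simp only [mem_team_sub, List.getElem?_map, Option.map_eq_some_iff]
  constructor
  · intro h i hi
    have hi' : i < T.rows.length := hu ▸ (List.getElem?_eq_some_iff.mp hi).1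
    exact ⟨_, List.getElem?_eq_getElem hi', h _ ⟨i, _, List.getElem?_eq_getElem hi', hi, rfl⟩⟩
  · rintro h s ⟨i, r, h₁, h₂, rfl⟩
    obtain ⟨r', h₃, h₄⟩ := h i h₂
    rw [h₁] at h₃
    injection h₃ with h₃
    exact h₃ ▸ h₄

theorem team_sub_replicate : (T.sub (List.replicate T.rows.length true)).team = T.team := by
  ext s
  rw [mem_team_sub]
  constructor
  · rintro ⟨i, r, h₁, -, rfl⟩
    exact ⟨r, List.mem_of_getElem? h₁, rfl⟩
  · rintro ⟨r, hr, rfl⟩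
    obtain ⟨i, hi, rfl⟩ := List.getElem_of_mem hr
    exact ⟨i, _, List.getElem?_eq_getElem hi, by simp [hi], rfl⟩

open Classical in
/-- The parts of a split of a subteam are subteams again, and hence have masks. -/
theorem exists_team_sub_eq {t : Team} {u : List Bool} (h : t ⊆ (T.sub u).team) :
    ∃ v ∈ allMasks T.rows.length, (T.sub v).team = t := by
  refine ⟨T.rows.map fun r => decide (rowAssignment T.vars r ∈ t), by simp [mem_allMasks], ?_⟩
  ext s
  rw [mem_team_sub]
  constructor
  · rintro ⟨i, r, h₁, h₂, rfl⟩
    simpa [h₁] using h₂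
  · intro hs
    obtain ⟨i, r, h₁, -, rfl⟩ := mem_team_sub.mp (h hs)
    exact ⟨i, r, h₁, by simp [h₁, hs], rfl⟩

/-- Splits are recognised by comparing masks bit by bit. -/
theorem isSplit_team_sub_iff {Γ : Type} {m : Semantics} {u v w : List Bool}
    (hu : u.length = T.rows.length) :
    m.IsSplit (T.sub u).team (T.sub v).team (T.sub w).team ↔ Prog.MaskSplit Γ m u v w := by
  have hbit : ∀ (z : List Bool) (i : ℕ), (z.map (Symbol.bit (Γ := Γ)))[i]? = some (.bit true) ↔
      z[i]? = some true := fun z i => by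
    simp [Option.map_eq_some_iff]
  have hlax : (T.sub v).team ∪ (T.sub w).team = (T.sub u).team ↔ ∀ i < T.rows.length,
      (u[i]? = some true ↔ v[i]? = some true ∨ w[i]? = some true) := by
    constructor
    · intro h i hi
      have hi' := List.getElem?_eq_getElem hi
      rw [← rowAssignment_mem_team_sub hi', ← rowAssignment_mem_team_sub hi',
        ← rowAssignment_mem_team_sub hi', ← h, Set.mem_union]
    · intro h
      ext s
      simp only [Set.mem_union, mem_team_sub]
      constructor
      · rintro (⟨i, r, h₁, h₂, rfl⟩ | ⟨i, r, h₁, h₂, rfl⟩)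
        · exact ⟨i, r, h₁, (h i (List.getElem?_eq_some_iff.mp h₁).1).mpr (.inl h₂), rfl⟩
        · exact ⟨i, r, h₁, (h i (List.getElem?_eq_some_iff.mp h₁).1).mpr (.inr h₂), rfl⟩
      · rintro ⟨i, r, h₁, h₂, rfl⟩
        rcases (h i (List.getElem?_eq_some_iff.mp h₁).1).mp h₂ with h₃ | h₃
        · exact .inl ⟨i, r, h₁, h₃, rfl⟩
        · exact .inr ⟨i, r, h₁, h₃, rfl⟩
  have hdisj : Disjoint (T.sub v).team (T.sub w).team ↔ ∀ i < T.rows.length,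
      ¬(v[i]? = some true ∧ w[i]? = some true) := by
    rw [Set.disjoint_left]
    constructor
    · rintro h i hi ⟨h₁, h₂⟩
      have hi' := List.getElem?_eq_getElem hi
      rw [← rowAssignment_mem_team_sub hi'] at h₁ h₂
      exact h h₁ h₂
    · intro h s h₁ h₂
      obtain ⟨i, r, hi, h₃, rfl⟩ := mem_team_sub.mp h₁
      exact h i (List.getElem?_eq_some_iff.mp hi).1 ⟨h₃, (rowAssignment_mem_team_sub hi).mp h₂⟩
  have hzip : ∀ R : Symbol Γ → Option (Symbol Γ) → Option (Symbol Γ) → Prop,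
      Prog.ZipRel R (u.map Symbol.bit) (v.map Symbol.bit) (w.map Symbol.bit) ↔
      ∀ (i : ℕ) (hi : i < T.rows.length), R (.bit (u[i]'(hu ▸ hi)))
        (v.map Symbol.bit)[i]? (w.map Symbol.bit)[i]? := by
    intro R
    constructor
    · intro h i hi
      exact h i _ (by simp [hu, hi])
    · intro h i c hc
      obtain ⟨hi, rfl⟩ := List.getElem?_eq_some_iff.mp hc
      simpa using h i (by simpa [hu] using hi)
  have hu' : ∀ (i : ℕ) (hi : i < T.rows.length), Symbol.bit (Γ := Γ) (u[i]'(hu ▸ hi)) = .bit true ↔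
      u[i]? = some true := fun i hi => by simp [hu, hi]
  cases m
  · simp only [Semantics.IsSplit, hlax, Prog.MaskSplit, hzip, Prog.splitRel, hbit]
    exact forall₂_congr fun i hi => by rw [hu' i hi]
  · simp only [Semantics.IsSplit, hlax, hdisj, Prog.MaskSplit, hzip, Prog.splitRel, hbit,
      ← forall_and]
    exact forall₂_congr fun i hi => by rw [hu' i hi]

theorem teamSize_eq_length : T.teamSize = T.rows.length := by
  have h : T.team = (rowAssignment T.vars) '' (T.rows.toFinset : Set (List Bool)) := by
    ext s
    simp [team, eq_comm]
  rw [teamSize, h, Set.InjOn.ncard_image, Set.ncard_coe_finset,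
    List.toFinset_card_of_nodup T.rows_nodup]
  intro r hr s hs e
  exact rowAssignment_injOn T.vars_nodup (T.length_row r (by simpa using hr))
    (T.length_row s (by simpa using hs)) e

end TeamTable

variable {L : Logic} {m : Semantics} {T : TeamTable} {u : List Bool}

/-- In the semantics of `∨`, the quantifiers over teams may be restricted to the finitely many teams
that have a mask. -/
theorem sat_or_iff {Γ : Type} (φ ψ : Formula L.Atom) (hu : u ∈ allMasks T.rows.length) :
    L.Sat m (T.sub u).team (.or φ ψ) ↔ ∃ v ∈ allMasks T.rows.length, L.Sat m (T.sub v).team φ ∧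
      ∃ w ∈ allMasks T.rows.length, L.Sat m (T.sub w).team ψ ∧ Prog.MaskSplit Γ m u v w := by
  rw [mem_allMasks] at hu
  constructor
  · rintro ⟨T₁, T₂, hs, h₁, h₂⟩
    have hsub : T₁ ∪ T₂ = (T.sub u).team := by
      cases m
      · exact hs
      · exact hs.1
    obtain ⟨v, hv, rfl⟩ := TeamTable.exists_team_sub_eq (T := T) (t := T₁) (u := u)
      (hsub ▸ Set.subset_union_left)
    obtain ⟨w, hw, rfl⟩ := TeamTable.exists_team_sub_eq (T := T) (t := T₂) (u := u)
      (hsub ▸ Set.subset_union_right)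
    exact ⟨v, hv, h₁, w, hw, h₂, (TeamTable.isSplit_team_sub_iff hu).mp hs⟩
  · rintro ⟨v, -, h₁, w, -, h₂, hs⟩
    exact ⟨_, _, (TeamTable.isSplit_team_sub_iff hu).mpr hs, h₁, h₂⟩

end TeamSemantics

namespace TeamSemantics

open Function

/-! ### Correctness of the model checking program -/

namespace Prog

variable {Γ : Type} {O : Oracle (Symbol Γ)} {B : ℕ} {S S' : Store Reg Γ} {p q : Prog Reg Γ}

theorem length_flatMap_encodeWord {M : List (List Bool)} {k : ℕ} (h : ∀ u ∈ M, u.length = k) :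
    (M.flatMap (encodeWord (Γ := Γ))).length = M.length * (k + 1) := by
  induction M with
  | nil => simp
  | cons u M ih =>
    simp only [List.mem_cons, forall_eq_or_imp] at h
    simp [ih h.2, encodeWord, h.1]
    ring

theorem length_flatMap_allMasks (k : ℕ) :
    ((allMasks k).flatMap (encodeWord (Γ := Γ))).length = 2 ^ k * (k + 1) := by
  rw [length_flatMap_encodeWord fun u => mem_allMasks.mp, length_allMasks]

theorem Runs.doubleMasks {k : ℕ} (hm : S .masks = (allMasks k).flatMap encodeWord)
    (ht : S .tmp = []) (hB : 2 ^ (k + 1) * (k + 2) ≤ B) :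
    (doubleMasks : Prog Reg Γ).Runs O B S
      (update S .masks ((allMasks (k + 1)).flatMap encodeWord)) := by
  have hlen := length_flatMap_allMasks (Γ := Γ) k
  have hlen' := length_flatMap_allMasks (Γ := Γ) (k + 1)
  have hk : (S .masks).length ≤ B := by
    rw [hm, hlen]
    refine le_trans (Nat.mul_le_mul ?_ ?_) hB
    · exact Nat.pow_le_pow_right (by omega) (by omega)
    · omega
  have hbit : ∀ b, ((allMasks k).flatMap encodeWord).flatMap (appendBit (Γ := Γ) b) =
      ((allMasks k).map (· ++ [b])).flatMap encodeWord := by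
    intro b
    rw [flatMap_encodeWord_flatMap]
    simp [encodeWord, appendBit, List.flatMap_map, ← List.map_eq_flatMap]
  have hall : (allMasks (k + 1)).flatMap (encodeWord (Γ := Γ)) =
      ((allMasks k).map (· ++ [true])).flatMap encodeWord ++
        ((allMasks k).map (· ++ [false])).flatMap encodeWord := by
    rw [allMasks, List.flatMap_append]
  have hk' : (((allMasks k).map (· ++ [true])).flatMap (encodeWord (Γ := Γ))).length +
      (((allMasks k).map (· ++ [false])).flatMap (encodeWord (Γ := Γ))).length ≤ B := by
    rw [← List.length_append, ← hall, hlen']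
    exact hB
  refine .cons (.translate hk) (.cons (.translate ?_) (.cons (.clear ?_) (.cons (.pour ?_)
    (.cons (.clear ?_) (.nil ?_)))))
  · simpa using hk
  · simpa using hk
  · simp only [ne_eq, reduceCtorEq, not_false_eq_true, update_of_ne, update_self, hm, hbit, ht,
      List.append_nil, List.length_append, List.length_reverse]
    omega
  · simp only [ne_eq, reduceCtorEq, not_false_eq_true, update_of_ne, update_self, hm, hbit, ht,
      List.append_nil, List.length_append, List.length_reverse]
    omega
  · simp only [ne_eq, reduceCtorEq, not_false_eq_true, update_of_ne, update_self, hm, hbit, ht,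
      List.append_nil, List.reverse_append, List.reverse_reverse, hall]
    funext v
    cases v <;> simp [ht]

theorem Runs.writeMasks {R : List (List Bool)} (hr : S .rows = R.flatMap encodeWord)
    (hm : S .masks = []) (hw : S .row = []) (ht : S .tmp = []) (hR : (S .rows).length ≤ B)
    (hB : 2 ^ R.length * (R.length + 1) ≤ B) : (writeMasks : Prog Reg Γ).Runs O B S
      (update S .masks ((allMasks R.length).flatMap encodeWord)) := by
  refine .cons (.push _ _) (.cons (.forWords (words := R)
    (fun pre => update S .masks ((allMasks pre.length).flatMap encodeWord)) ?_ ?_ ?_ ?_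
    fun pre r suf e => ?_) (.nil rfl))
  · simpa using hr
  · simpa using hR
  · simp [hm, allMasks, encodeWord]
  · simp [hw]
  · refine (Runs.doubleMasks (k := pre.length) ?_ ?_ ?_).congr ?_
    · simp
    · simp [ht]
    · have : pre.length + 1 ≤ R.length := by simp [e]
      exact (Nat.mul_le_mul (Nat.pow_le_pow_right (by omega) this) (by omega)).trans hB
    · funext v
      cases v <;> simp

theorem Runs.readTable {X R F : List (Symbol Γ)} (hX : Symbol.bar ∉ X) (hR : Symbol.bar ∉ R)
    (hi : S .input = X ++ [.bar] ++ R ++ [.bar] ++ F) (hv : S .vars = []) (hr : S .rows = [])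
    (ht : S .tmp = []) (hf : S .flag = []) (hB : (S .input).length ≤ B) :
    (readTable : Prog Reg Γ).Runs O B S
      (update (update (update S .input F) .vars X) .rows R) := by
  have hB' := hB
  simp [hi] at hB'
  refine .cons (.popUntil (u := X) (rest := R ++ [.bar] ++ F) (by simp) (by simp) (by simp)
    ?_ hX ht hf hB) (.cons (.pour ?_) (.cons (.clear ?_) (.cons (.popUntil (u := R) (rest := F)
    (by simp) (by simp) (by simp) ?_ hR ?_ ?_ ?_) (.cons (.pour ?_) (.cons (.clear ?_)
    (.nil ?_))))))
  · simp [hi]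
  · simp; omega
  · simp; omega
  · simp
  · simp
  · simp [hf]
  · simp; omega
  · simp; omega
  · simp; omega
  · funext v
    cases v <;> simp [hv, hr, ht]

end Prog

variable (L : Logic)

/-- The machine for the atoms of a logic. -/
noncomputable def atomOracle (hL : L.AtomsPTimeCheckable) : Oracle (Symbol L.Alphabet) where
  aux := hL.some.toTM2ComputableAux
  time := hL.some.time
  -- every question that is asked encodes a table and an atom
  ans w b := ∃ (T : TeamTable) (α : L.Atom),
    w = L.encodeInstance (T, .atom α) ∧ (b = true ↔ L.sat T.team α)
  correct := by
    rintro w b ⟨T, α, rfl, h⟩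
    refine ⟨?_⟩
    convert! hL.some.outputsFun (T, α)
    classical
    by_cases hs : L.sat T.team α
    · simp [hs, h.mpr hs]
    · have hb : b = false := by
        cases b
        · rfl
        · exact absurd (h.mp rfl) hs
      simp [hs, hb]

namespace Prog

variable {L} {O : Oracle (Symbol L.Alphabet)} {B : ℕ} {m : Semantics} {T : TeamTable}

open Classical in
/-- The truth value of `φ` in the team with the mask `u`. -/
noncomputable def value (m : Semantics) (T : TeamTable) (φ : Formula L.Atom) (u : List Bool) :
    Bool := decide (L.Sat m (T.sub u).team φ)

theorem value_eq_true_iff {φ : Formula L.Atom} {u : List Bool} :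
    value m T φ u = true ↔ L.Sat m (T.sub u).team φ := by
  simp [value]

/-- The precondition for the evaluation of a formula. -/
structure Ready (T : TeamTable) (S : Store Reg L.Alphabet) : Prop extends Clean S where
  vars : S .vars = T.vars.flatMap encodeWord
  rows : S .rows = T.rows.flatMap encodeWord
  masks : S .masks = (allMasks T.rows.length).flatMap encodeWord
  kind : S .kind = []
  name : S .name = []
  col : S .col = []

theorem Ready.update_stack {S : Store Reg L.Alphabet} (h : Ready T S)
    (l : List (Symbol L.Alphabet)) : Ready T (update S .stack l) := by
  constructor
  · constructor <;> simp [h.flag, h.vecL, h.vecR, h.vecOut, h.itL, h.itR, h.mask, h.maskL, h.maskR,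
        h.row, h.var, h.z₁, h.z₂, h.z₃, h.ok, h.hit, h.arg, h.tmp]
  all_goals simp [h.vars, h.rows, h.masks, h.kind, h.name, h.col]

/-- The loop over the symbols of a formula, from the symbols `l` on, ends in `S'`. -/
def LoopRuns (O : Oracle (Symbol L.Alphabet)) (B : ℕ) (m : Semantics)
    (l : List (Symbol L.Alphabet)) (S S' : Store Reg L.Alphabet) : Prop :=
  ∀ Q : Store Reg L.Alphabet → Prop, Q S' → wpLoop (fun a => wp O B (token m a)) l Q S

theorem LoopRuns.cons {a : Symbol L.Alphabet} {l : List (Symbol L.Alphabet)}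
    {S S₁ S' : Store Reg L.Alphabet} (h : (token m a).Runs O B S S₁) (hl : LoopRuns O B m l S₁ S') :
    LoopRuns O B m (a :: l) S S' := fun Q hQ => h _ (hl Q hQ)

theorem LoopRuns.names {w l : List (Symbol L.Alphabet)} {S S' : Store Reg L.Alphabet}
    (hw : ∀ a ∈ w, (∃ b, a = .bit b) ∨ ∃ g, a = .chr g)
    (h : LoopRuns O B m l (update S .name (w.reverse ++ S .name)) S') :
    LoopRuns O B m (w ++ l) S S' := by
  induction w generalizing S with
  | nil => simpa using h
  | cons a w ih =>
    simp only [List.mem_cons, forall_eq_or_imp] at hw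
    have hp : token m a = .push .name a := by
      rcases hw.1 with ⟨b, rfl⟩ | ⟨g, rfl⟩ <;> rfl
    refine .cons (by rw [hp]; exact Runs.push _ _) (ih hw.2 ?_)
    simpa using h

/-- Reading a literal or an atom. -/
theorem LoopRuns.read {a : Symbol L.Alphabet} {w l : List (Symbol L.Alphabet)}
    {S S₁ S' : Store Reg L.Alphabet} (ha : (token m a) = push .kind a)
    (hw : ∀ a ∈ w, (∃ b, a = .bit b) ∨ ∃ g, a = .chr g)
    (he : (token m .endmark).Runs O B
      (update (update S .kind (a :: S .kind)) .name (w.reverse ++ S .name)) S₁)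
    (h : LoopRuns O B m l S₁ S') : LoopRuns O B m (a :: (w ++ [.endmark]) ++ l) S S' := by
  rw [List.cons_append, List.append_assoc]
  refine .cons (by rw [ha]; exact .push _ _) (.names hw (.cons ?_ h))
  simpa using he

theorem one_le_length_encodeFormula (φ : Formula L.Atom) : 1 ≤ (L.encodeFormula φ).length := by
  cases φ <;> simp [Logic.encodeFormula] <;> omega

theorem Clean.update {S : Store Reg L.Alphabet} (h : Clean S) {x : Reg}
    (hx : x = .kind ∨ x = .name ∨ x = .col ∨ x = .stack) (l : List (Symbol L.Alphabet)) :
    Clean (update S x l) := by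
  rcases hx with rfl | rfl | rfl | rfl <;> constructor <;>
    simp [h.flag, h.vecL, h.vecR, h.vecOut, h.itL, h.itR, h.mask, h.maskL, h.maskR, h.row, h.var,
      h.z₁, h.z₂, h.z₃, h.ok, h.hit, h.arg, h.tmp]

/-- The value of a formula that holds in a team iff each assignment in the team satisfies `P`. -/
theorem Runs.flatVec_value {S : Store Reg L.Alphabet} {φ : Formula L.Atom} {P : Assignment → Bool}
    (hφ : ∀ t : Team, L.Sat m t φ ↔ ∀ s ∈ t, P s = true) (hS : Clean S)
    (hm : S .masks = (allMasks T.rows.length).flatMap encodeWord)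
    (hc : S .col = ((T.rows.map fun r => P (rowAssignment T.vars r)).map Symbol.bit).reverse)
    (hB : 1 ≤ B) (hM : (S .masks).length ≤ B) (hR : T.rows.length ≤ B) :
    (Prog.flatVec : Prog Reg L.Alphabet).Runs O B S
      (update (update S .col []) .stack
        (encodeWord ((allMasks T.rows.length).map (value m T φ)) ++ S .stack)) := by
  refine .flatVec hS hm hc (fun u hu => ?_) hB hM (by simpa using hR)
  rw [value_eq_true_iff, hφ, TeamTable.forall_mem_team_sub (mem_allMasks.mp hu)]

/-- The value of `⊤` or `⊥`. -/
theorem Ready.runs_const {S : Store Reg L.Alphabet} (hS : Ready T S) {b : Bool}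
    {φ : Formula L.Atom} (hφ : ∀ t : Team, L.Sat m t φ ↔ ∀ s ∈ t, b = true)
    (hB : (S .rows).length + 1 ≤ B) (hM : (S .masks).length ≤ B) (hR : T.rows.length ≤ B) :
    (block [constCol b, flatVec]).Runs O B S (update S .stack
      (encodeWord ((allMasks T.rows.length).map (value m T φ)) ++ S .stack)) := by
  refine .cons (.constCol hS.rows hS.col (by omega))
    (.cons (.flatVec_value (P := fun _ => b) hφ (hS.toClean.update (by simp) _) ?_ ?_ ?_ ?_ hR)
    (.nil ?_))
  · simp [hS.masks]
  · simp
  · omega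
  · simpa using hM
  · funext v
    cases v <;> simp [hS.col]

/-- The value of a literal, after its name has been read. -/
theorem Ready.runs_literal {S : Store Reg L.Alphabet} (hS : Ready T S) {b : Bool} {x : Var}
    {φ : Formula L.Atom} (hφ : ∀ t : Team, L.Sat m t φ ↔ ∀ s ∈ t, (s x == b) = true)
    (hB : (S .vars).length + (S .rows).length + x.length + 1 ≤ B) (hM : (S .masks).length ≤ B)
    (hR : T.rows.length ≤ B) :
    (token m .endmark).Runs O B
      (update (update S .kind ((if b then .pos else .neg) :: S .kind)) .name
        ((x.map Symbol.bit).reverse ++ S .name))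
      (update S .stack
        (encodeWord ((allMasks T.rows.length).map (value m T φ)) ++ S .stack)) := by
  rw [hS.name, hS.kind, List.append_nil]
  set S₁ := update (update S .kind [if b then .pos else .neg]) .name
    (x.map Symbol.bit).reverse with hS₁
  have hC : Clean S₁ := (hS.toClean.update (by simp) _).update (by simp) _
  refine .cons (S₁ := update S₁ .stack
    (encodeWord ((allMasks T.rows.length).map (value m T φ)) ++ S .stack)) ?_
    (.cons (.clear ?_) (.cons (.clear ?_) (.nil ?_)))
  · have hb : (block [litCol b, flatVec] : Prog Reg L.Alphabet).Runs O B S₁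
        (update S₁ .stack
          (encodeWord ((allMasks T.rows.length).map (value m T φ)) ++ S .stack)) := by
      refine .cons (.litCol (R := T.rows) (X := T.vars) (x := x)
        (F := fun r => rowAssignment T.vars r x == b) hC ?_ ?_ ?_ ?_ ?_ ?_ ?_ ?_ ?_)
        (.cons (.flatVec_value (P := fun s => s x == b) hφ (hC.update (by simp) _) ?_ ?_ ?_ ?_ hR)
        (.nil ?_))
      · simp [hS₁, hS.rows]
      · simp [hS₁, hS.vars]
      · simp [hS₁]
      · simp [hS₁, hS.col]
      · intro r hr
        rw [← rowAssignment_eq_true_iff T.vars_nodup (T.length_row r hr)]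
        cases b <;> cases rowAssignment T.vars r x <;> simp
      · omega
      · simp [hS₁]; omega
      · simp [hS₁]; omega
      · omega
      · simp [hS₁, hS.masks]
      · simp
      · omega
      · simpa [hS₁] using hM
      · funext v
        cases v <;> simp [hS₁, hS.col]
    refine .case (o := some (if b then .pos else .neg)) (by simp [hS₁]) ?_
    cases b <;> exact hb
  · simp [hS₁]; omega
  · simp [hS₁]; omega
  · funext v
    cases v <;> simp [hS₁, hS.kind, hS.name]

/-- The value of an atom, after its name has been read. -/
theorem Ready.runs_atom (hO : ∀ (T : TeamTable) (α : L.Atom) (b : Bool),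
      (b = true ↔ L.sat T.team α) → O.ans (L.encodeInstance (T, .atom α)) b)
    {S : Store Reg L.Alphabet} (hS : Ready T S) {α : L.Atom}
    (hB : (S .vars).length + (S .rows).length + (L.code.encode α).length + 4 ≤ B)
    (hM : (S .masks).length ≤ B) :
    (token m .endmark).Runs O B
      (update (update S .kind (.atom :: S .kind)) .name
        (((L.code.encode α).map Symbol.chr).reverse ++ S .name))
      (update S .stack
        (encodeWord ((allMasks T.rows.length).map (value m T (.atom α))) ++ S .stack)) := by
  rw [hS.name, hS.kind, List.append_nil]
  set S₁ := update (update S .kind [.atom]) .name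
    ((L.code.encode α).map Symbol.chr).reverse with hS₁
  have hC : Clean S₁ := (hS.toClean.update (by simp) _).update (by simp) _
  refine .cons (.case (o := some .atom) (by simp [hS₁]) (.atomVec (M := allMasks T.rows.length)
    (R := T.rows) (F := value m T (.atom α)) hC ?_ ?_ ?_ ?_ ?_))
    (.cons (.clear ?_) (.cons (.clear ?_) (.nil ?_)))
  · simp [hS₁, hS.masks]
  · simp [hS₁, hS.rows]
  · intro u hu
    convert! hO (T.sub u) α (value m T (.atom α) u) ?_ using 1
    · simp [hS₁, hS.vars, Logic.encodeInstance, TeamTable.encode, TeamTable.sub,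
        Logic.encodeFormula]
    · rw [value_eq_true_iff, Logic.Sat]
  · simpa [hS₁] using hM
  · simpa [hS₁] using hB
  · simp [hS₁]; omega
  · simp [hS₁]; omega
  · funext v
    cases v <;> simp [hS₁, hS.kind, hS.name]

/-- Evaluating the formula `φ`, written in reverse Polish notation, pushes its vector of truth
values to the evaluation stack. The bounds say that the input, all masks, and one vector for each
symbol of `φ` fit into `B`. -/
theorem loopRuns_encodeFormula (hO : ∀ (T : TeamTable) (α : L.Atom) (b : Bool),
      (b = true ↔ L.sat T.team α) → O.ans (L.encodeInstance (T, .atom α)) b)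
    (φ : Formula L.Atom) {S S' : Store Reg L.Alphabet} {l : List (Symbol L.Alphabet)}
    (hS : Ready T S) (hB : (S .vars).length + (S .rows).length + (L.encodeFormula φ).length + 4 ≤ B)
    (hM : (S .masks).length ≤ B)
    (hst : (S .stack).length + (L.encodeFormula φ).length * (2 ^ T.rows.length + 1) ≤ B)
    (h : LoopRuns O B m l (update S .stack
      (encodeWord ((allMasks T.rows.length).map (value m T φ)) ++ S .stack)) S') :
    LoopRuns O B m (L.encodeFormula φ ++ l) S S' := by
  have hR : T.rows.length ≤ B := by
    have := length_le_length_flatMap_encodeWord (Γ := L.Alphabet) T.rows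
    rw [← hS.rows] at this
    omega
  induction φ generalizing S l with
  | top => exact .cons (hS.runs_const (by simp [Logic.Sat]) (by omega) hM hR) h
  | bot =>
    refine .cons (hS.runs_const ?_ (by omega) hM hR) h
    simp [Logic.Sat, Set.eq_empty_iff_forall_notMem]
  | pos x =>
    have hx : (L.encodeFormula (.pos x)).length = x.length + 2 := by
      simp [Logic.encodeFormula, encodeWord]
    exact .read rfl (fun a ha => by
      obtain ⟨c, -, rfl⟩ := List.mem_map.mp ha
      exact .inl ⟨c, rfl⟩) (hS.runs_literal (b := true) (by simp [Logic.Sat]) (by omega) hM hR) h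
  | neg x =>
    have hx : (L.encodeFormula (.neg x)).length = x.length + 2 := by
      simp [Logic.encodeFormula, encodeWord]
    exact .read rfl (fun a ha => by
      obtain ⟨c, -, rfl⟩ := List.mem_map.mp ha
      exact .inl ⟨c, rfl⟩) (hS.runs_literal (b := false) (by simp [Logic.Sat]) (by omega) hM hR) h
  | atom α =>
    have hx : (L.encodeFormula (.atom α)).length = (L.code.encode α).length + 2 := by
      simp [Logic.encodeFormula]
    exact .read rfl (fun a ha => by
      obtain ⟨c, -, rfl⟩ := List.mem_map.mp ha
      exact .inr ⟨c, rfl⟩) (hS.runs_atom hO (by omega) hM) h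
  | and φ ψ ihφ ihψ =>
    have hx : (L.encodeFormula (.and φ ψ)).length =
        (L.encodeFormula φ).length + (L.encodeFormula ψ).length + 1 := by
      simp [Logic.encodeFormula, add_assoc]
    have hpos := Nat.two_pow_pos T.rows.length
    rw [hx] at hB hst
    rw [add_mul, add_mul, one_mul] at hst
    have hφ := Nat.le_mul_of_pos_left (2 ^ T.rows.length + 1) (one_le_length_encodeFormula φ)
    have hψ := Nat.le_mul_of_pos_left (2 ^ T.rows.length + 1) (one_le_length_encodeFormula ψ)
    rw [Logic.encodeFormula, List.append_assoc, List.append_assoc]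
    refine ihφ hS (by omega) hM (by omega) (ihψ (hS.update_stack _) ?_ ?_ ?_
      (.cons (.andVec (M := allMasks T.rows.length) (F := value m T φ) (G := value m T ψ)
      (rest := S .stack) ((hS.update_stack _).update_stack _).toClean ?_ ?_) ?_))
    · simp; omega
    · simpa using hM
    · simp [encodeWord, length_allMasks]; omega
    · simp
    · simp [encodeWord, length_allMasks]; omega
    · convert! h using 1
      have hv : (fun u => value m T φ u && value m T ψ u) = value m T (.and φ ψ) := by
        funext u
        rw [Bool.eq_iff_iff, Bool.and_eq_true, value_eq_true_iff, value_eq_true_iff,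
          value_eq_true_iff, Logic.Sat]
      simp [hv]
  | or φ ψ ihφ ihψ =>
    have hx : (L.encodeFormula (.or φ ψ)).length =
        (L.encodeFormula φ).length + (L.encodeFormula ψ).length + 1 := by
      simp [Logic.encodeFormula, add_assoc]
    have hpos := Nat.two_pow_pos T.rows.length
    rw [hx] at hB hst
    rw [add_mul, add_mul, one_mul] at hst
    have hφ := Nat.le_mul_of_pos_left (2 ^ T.rows.length + 1) (one_le_length_encodeFormula φ)
    have hψ := Nat.le_mul_of_pos_left (2 ^ T.rows.length + 1) (one_le_length_encodeFormula ψ)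
    rw [Logic.encodeFormula, List.append_assoc, List.append_assoc]
    refine ihφ hS (by omega) hM (by omega) (ihψ (hS.update_stack _) ?_ ?_ ?_
      (.cons (.orVec (M := allMasks T.rows.length) (F := value m T φ) (G := value m T ψ)
      (H := value m T (.or φ ψ)) (rest := S .stack)
      ((hS.update_stack _).update_stack _).toClean ?_ ?_ ?_ ?_ ?_) ?_))
    · simp; omega
    · simpa using hM
    · simp [encodeWord, length_allMasks]; omega
    · simp [hS.masks]
    · simp
    · intro u hu
      simpa [value_eq_true_iff] using sat_or_iff (Γ := L.Alphabet) φ ψ hu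
    · simp [encodeWord, length_allMasks]; omega
    · simpa using hM
    · convert! h using 1
      simp

end Prog
end TeamSemantics

namespace TeamSemantics

open Function

namespace Prog

variable {L : Logic} {O : Oracle (Symbol L.Alphabet)} {B : ℕ} {m : Semantics} {T : TeamTable}

theorem bar_notMem_flatMap_encodeWord {Γ : Type} (words : List (List Bool)) :
    Symbol.bar ∉ words.flatMap (encodeWord (Γ := Γ)) := by
  simp [encodeWord]

/-- The model checking program computes the truth value of `φ` in the team, which is the first
entry of the vector of truth values of `φ`. -/
theorem Runs.modelCheck (hO : ∀ (T : TeamTable) (α : L.Atom) (b : Bool),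
      (b = true ↔ L.sat T.team α) → O.ans (L.encodeInstance (T, .atom α)) b)
    {φ : Formula L.Atom} (hB : (L.encodeInstance (T, φ)).length + 4 ≤ B)
    (hM : 2 ^ T.rows.length * (T.rows.length + 1) ≤ B)
    (hst : (L.encodeInstance (T, φ)).length * (2 ^ T.rows.length + 1) ≤ B)
    {b : Bool} (hb : b = true ↔ L.Sat m T.team φ) :
    (modelCheck m : Prog Reg L.Alphabet).Runs O B
      (update (fun _ => []) .input (L.encodeInstance (T, φ)))
      (update (fun _ => []) .answer [.bit b]) := by
  have hw : L.encodeInstance (T, φ) = T.vars.flatMap encodeWord ++ [Symbol.bar] ++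
      T.rows.flatMap encodeWord ++ [Symbol.bar] ++ L.encodeFormula φ := rfl
  have hlen : (L.encodeInstance (T, φ)).length =
      (T.vars.flatMap (encodeWord (Γ := L.Alphabet))).length +
        (T.rows.flatMap (encodeWord (Γ := L.Alphabet))).length +
        (L.encodeFormula φ).length + 2 := by
    simp only [hw, List.length_append, List.length_cons, List.length_nil]
    omega
  have hst' : (L.encodeFormula φ).length * (2 ^ T.rows.length + 1) ≤ B :=
    (Nat.mul_le_mul_right _ (by omega)).trans hst
  have hφ := Nat.le_mul_of_pos_left (2 ^ T.rows.length + 1) (one_le_length_encodeFormula φ)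
  set S₁ : Store Reg L.Alphabet := update (update (update (update (fun _ => []) .input
    (L.encodeFormula φ)) .vars (T.vars.flatMap encodeWord)) .rows (T.rows.flatMap encodeWord))
    .masks ((allMasks T.rows.length).flatMap encodeWord) with hS₁
  have hS : Ready T S₁ := by
    constructor
    · constructor <;> simp [hS₁]
    all_goals simp [hS₁]
  refine .cons (.readTable (bar_notMem_flatMap_encodeWord T.vars)
    (bar_notMem_flatMap_encodeWord T.rows) (F := L.encodeFormula φ) ?_ ?_ ?_ ?_ ?_ ?_)
    (.cons (.writeMasks (R := T.rows) ?_ ?_ ?_ ?_ ?_ hM) (.cons (S₁ := update S₁ .stack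
      (encodeWord ((allMasks T.rows.length).map (value m T φ)))) ?_
    (.cons (S₁ := update (update S₁ .stack
      (encodeWord ((allMasks T.rows.length).map (value m T φ)))) .answer [.bit b]) ?_
    (.cons (.clear ?_) (.cons (.clear ?_) (.cons (.clear ?_) (.cons (.clear ?_)
    (.cons (.clear ?_) (.nil ?_)))))))))
  · simp [hw]
  · simp
  · simp
  · simp
  · simp
  · simp; omega
  · simp
  · simp
  · simp
  · simp
  · simp [-List.length_flatMap]; omega
  · intro Q hQ
    have hin : S₁ .input = L.encodeFormula φ := by simp [hS₁]
    have hsum : (S₁ .vars).length + (S₁ .rows).length + (L.encodeFormula φ).length + 4 ≤ B := by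
      rw [hS.vars, hS.rows]
      omega
    have key : LoopRuns O B m (L.encodeFormula φ ++ []) S₁ (update S₁ .stack
        (encodeWord ((allMasks T.rows.length).map (value m T φ)))) := by
      refine loopRuns_encodeFormula hO φ hS hsum ?_ ?_ fun Q hQ => ?_
      · rw [hS.masks, length_flatMap_allMasks]
        exact hM
      · simpa [hS₁] using hst'
      · simpa [hS₁, wpLoop] using hQ
    rw [List.append_nil] at key
    have hS₁' : update (update (update (update (update (fun _ => []) .input
        (L.encodeInstance (T, φ))) .input (L.encodeFormula φ)) .vars (T.vars.flatMap encodeWord))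
        .rows (T.rows.flatMap encodeWord)) .masks
        ((allMasks T.rows.length).flatMap encodeWord) = S₁ := by
      rw [hS₁, update_idem]
    rw [hS₁']
    refine ⟨?_, ?_⟩
    · rw [hin]
      omega
    · rw [hin]
      exact key Q hQ
  · have hhead : (update S₁ .stack (encodeWord ((allMasks T.rows.length).map (value m T φ)))
        .stack).head? = some (.bit b) := by
      have h₁ := head?_allMasks T.rows.length
      have h₂ : value m T φ (List.replicate T.rows.length true) = b := by
        rw [Bool.eq_iff_iff, hb, value_eq_true_iff, TeamTable.team_sub_replicate]
      cases h : allMasks T.rows.length with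
      | nil => simp [h] at h₁
      | cons u M =>
        rw [h, List.head?_cons, Option.some.injEq] at h₁
        simp [encodeWord, h₁, h₂]
    refine .ifTrue (fun h => ?_) fun h => ?_
    · rw [hhead] at h
      obtain rfl : b = true := by simpa using h
      exact (Runs.push _ _).congr (by simp [hS₁])
    · rw [hhead] at h
      obtain rfl : b = false := by simpa using h
      exact (Runs.push _ _).congr (by simp [hS₁])
  · simp [hS₁, -List.length_flatMap]; omega
  · simp [hS₁, -List.length_flatMap]; omega
  · simp [hS₁, -List.length_flatMap]; omega
  · simp only [hS₁, ne_eq, reduceCtorEq, not_false_eq_true, update_of_ne, update_self]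
    rw [length_flatMap_allMasks]
    exact hM
  · simp [hS₁, encodeWord, length_allMasks]; omega
  · funext v
    cases v <;> simp [hS₁]

end Prog

/-! ### Fixed-parameter tractability -/

/-- This separates the two factors of the bound for the stacks, of which the first one depends on
the parameter only, and the second one is linear in the length of the input. -/
theorem eval_mul_le_eval_mul_eval (p : Polynomial ℕ) (a b : ℕ) :
    p.eval (a * b) ≤ p.eval a * p.eval b := by
  rw [Polynomial.eval_eq_sum_range, Polynomial.eval_eq_sum_range, Polynomial.eval_eq_sum_range,
    Finset.sum_mul_sum]
  refine Finset.sum_le_sum fun i hi => ?_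
  refine le_trans ?_ (Finset.single_le_sum (fun j _ => Nat.zero_le _) hi)
  rcases Nat.eq_zero_or_pos (p.coeff i) with h | h
  · simp [h]
  · calc p.coeff i * (a * b) ^ i = p.coeff i * a ^ i * (1 * b ^ i) := by ring
      _ ≤ _ := by gcongr; exact h

theorem primrec_eval (p : Polynomial ℕ) : Primrec fun n : ℕ => p.eval n := by
  induction p using Polynomial.induction_on' with
  | add p q hp hq => simpa using Primrec.nat_add.comp hp hq
  | monomial n a =>
    have hpow : Primrec₂ ((· ^ ·) : ℕ → ℕ → ℕ) := Primrec₂.unpaired'.1 Nat.Primrec.pow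
    simpa using Primrec.nat_mul.comp (Primrec.const a) (hpow.comp Primrec.id (Primrec.const n))

theorem computable_eval_four_pow (p : Polynomial ℕ) :
    Computable fun k : ℕ => p.eval (4 ^ (k + 1)) := by
  have hpow : Primrec₂ ((· ^ ·) : ℕ → ℕ → ℕ) := Primrec₂.unpaired'.1 Nat.Primrec.pow
  exact ((primrec_eval p).comp (hpow.comp (Primrec.const 4) Primrec.succ)).to_comp

/-- Model checking is fixed-parameter tractable, by the program `Prog.modelCheck`. -/
theorem Logic.isFPT_modelChecking (L : Logic) (hL : L.AtomsPTimeCheckable) (m : Semantics) :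
    IsFPT L.encodeInstance (fun i => i.1.teamSize) (L.ModelChecking m) := by
  classical
  have := L.alphabetFinite
  let O := atomOracle L hL
  let p : Prog Reg L.Alphabet := Prog.modelCheck m
  let W : Polynomial ℕ := p.cost O + 1
  refine ⟨fun k => W.eval (4 ^ (k + 1)), W.comp (Polynomial.X + 1), machine O p .input .answer,
    computable_eval_four_pow W, ?_⟩
  rintro ⟨T, φ⟩
  set N := (L.encodeInstance (T, φ)).length with hN
  beta_reduce
  rw [TeamTable.teamSize_eq_length]
  set k := T.rows.length with hk
  -- all masks have `2 ^ k * (k + 1)` symbols, and at most `N` vectors are on the evaluation stack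
  set B := 4 ^ (k + 1) * (N + 1) with hB
  have hk' : k + 1 ≤ 2 ^ k := Nat.lt_two_pow_self
  have h4 : 4 ^ (k + 1) = 4 * (2 ^ k * 2 ^ k) := by
    rw [pow_succ, ← mul_pow]
    ring
  have h1 : 1 ≤ 2 ^ k := Nat.one_le_two_pow
  have h2 : 2 ^ k ≤ 2 ^ k * 2 ^ k := Nat.le_mul_of_pos_left _ h1
  have hB₁ : N + 4 ≤ B := calc
    N + 4 ≤ 4 * 1 * (N + 1) := by omega
    _ ≤ B := by rw [hB, h4]; gcongr; omega
  have hB₂ : 2 ^ k * (k + 1) ≤ B := calc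
    2 ^ k * (k + 1) ≤ 4 * (2 ^ k * 2 ^ k) * 1 := by nlinarith
    _ ≤ B := by rw [hB, h4]; gcongr; omega
  have hB₃ : N * (2 ^ k + 1) ≤ B := calc
    N * (2 ^ k + 1) ≤ (N + 1) * (4 * (2 ^ k * 2 ^ k)) := by gcongr <;> omega
    _ = B := by rw [hB, h4, mul_comm]
  have hrun := Prog.Runs.modelCheck (O := O) (B := B) (m := m) (T := T) (φ := φ)
    (b := decide (L.ModelChecking m (T, φ))) (fun T α b h => ⟨T, α, rfl, h⟩)
    hB₁ hB₂ hB₃ decide_eq_true_iff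
  obtain ⟨h⟩ := machine_outputsInTime (hrun _ rfl)
  refine ⟨⟨h.toEvalsTo, h.steps_le_m.trans ?_⟩⟩
  have hN' : (W.comp (Polynomial.X + 1)).eval N = W.eval (N + 1) := by simp [Polynomial.eval_comp]
  rw [hN']
  refine le_trans (le_of_eq ?_) (eval_mul_le_eval_mul_eval W _ _)
  simp [W, p, hB]

end TeamSemantics

theorem mainTheorem1 (L : TeamSemantics.Logic) (hL : L.AtomsPTimeCheckable) :
    ∀ m : TeamSemantics.Semantics,
      TeamSemantics.IsFPT L.encodeInstance (fun i => i.1.teamSize) (L.ModelChecking m) :=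
  L.isFPT_modelChecking hL
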